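/- Let $G$ be a compact connected semisimple Lie group with Lie algebra $\mathfrak g$, let $H=C_G(S)$ be the centraliser of a torus $S\subset G$ (so that $M=G/H$ is a generalised flag manifold), and let $\mathfrak h\subset\mathfrak g$ be the Lie algebra of $H$. Let $Q$ be any scalar product on $\mathfrak g$ induced by a bi-invariant Riemannian metric on $G$. For subspaces $\mathfrak u\subset\mathfrak v$ of $\mathfrak g$ write $\mathfrak v\ominus\mathfrak u$ for the $Q$-orthogonal complement of $\mathfrak u$ in $\mathfrak v$, and put $\mathfrak m=\mathfrak g\ominus\mathfrak h$. Then the following hold. 1. Every Lie subalgebra $\mathfrak s\subset\mathfrak g$ with $\mathfrak h\subset\mathfrak s$ and $\mathfrak h\neq\mathfrak s$ satisfies: (a) the representations $\mathrm{Ad}(H)|_{\mathfrak u}$ and $\mathrm{Ad}(H)|_{\mathfrak v}$ are inequivalent for every pair of nonzero $\mathrm{Ad}(H)$-invariant subspaces $\mathfrak u\subset\mathfrak s\ominus\mathfrak h$ and $\mathfrak v\subset\mathfrak g\ominus\mathfrak s$; (b) $[\mathfrak r,\mathfrak s]\neq\{0\}$ for every $1$-dimensional $\mathrm{Ad}(H)$-invariant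 subspace $\mathfrak r\subset\mathfrak g\ominus\mathfrak s$. 2. For every $Q$-orthogonal decomposition $\mathfrak m=\mathfrak m_1\oplus\cdots\oplus\mathfrak m_s$ into $\mathrm{Ad}(H)$-invariant subspaces on which $\mathrm{Ad}(H)$ acts irreducibly, $\mathrm{Ad}(H)|_{\mathfrak m_i}$ and $\mathrm{Ad}(H)|_{\mathfrak m_j}$ are inequivalent whenever $i\neq j$, and $\dim\mathfrak m_i$ is even for every $i$. 3. $\mathfrak m$ has no $1$-dimensional $\mathrm{Ad}(H)$-invariant subspace. -/

import Mathlib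

open scoped Manifold ContDiff

noncomputable section

namespace FlagManifold

/-- A smooth real Lie group is smooth enough for its tangent space at `1` to be a Lie algebra. -/
instance instLEInftyMinSmoothness : ENat.LEInfty (minSmoothness ℝ 3) :=
  ⟨by
    rw [minSmoothness_of_isRCLikeNormedField]
    exact ENat.LEInfty.out⟩

section LieGroup

variable {E : Type*} [NormedAddCommGroup E] [NormedSpace ℝ E]
  {G : Type*} [TopologicalSpace G] [ChartedSpace E G] [Group G]

/-- The adjoint representation: `Ad g` is the differential at `1` of `x ↦ g * x * g⁻¹`
(whose value at `1` is `1`). -/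
def Ad (g : G) : GroupLieAlgebra 𝓘(ℝ, E) G →L[ℝ] GroupLieAlgebra 𝓘(ℝ, E) G :=
  mfderiv 𝓘(ℝ, E) 𝓘(ℝ, E) (fun x : G => g * x * g⁻¹) 1

/-- `v` is the velocity at `t = 0` of a `C¹` curve in `G` that starts at `1` and stays in `H`. -/
def IsVelocity (H : Subgroup G) (v : GroupLieAlgebra 𝓘(ℝ, E) G) : Prop :=
  ∃ γ : ℝ → G, ContMDiff 𝓘(ℝ, ℝ) 𝓘(ℝ, E) 1 γ ∧ (∀ t, γ t ∈ H) ∧ γ 0 = 1 ∧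
    mfderiv 𝓘(ℝ, ℝ) 𝓘(ℝ, E) γ 0 (1 : ℝ) = (v : E)

theorem IsVelocity.zero (H : Subgroup G) :
    IsVelocity H (0 : GroupLieAlgebra 𝓘(ℝ, E) G) := by
  refine ⟨fun _ => 1, contMDiff_const, fun _ => H.one_mem, rfl, ?_⟩
  rw [mfderiv_const]
  rfl

theorem IsVelocity.smul {H : Subgroup G} {v : GroupLieAlgebra 𝓘(ℝ, E) G} (c : ℝ)
    (hv : IsVelocity H v) : IsVelocity H (c • v) := by
  obtain ⟨γ, h1, h2, h3, h4⟩ := hv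
  have hl : HasMFDerivAt 𝓘(ℝ, ℝ) 𝓘(ℝ, ℝ) (fun t : ℝ => c * t) 0
      (c • ContinuousLinearMap.id ℝ ℝ) := by
    have : HasFDerivAt (fun t : ℝ => c * t) (c • ContinuousLinearMap.id ℝ ℝ) 0 :=
      (hasFDerivAt_id (0 : ℝ)).const_mul c
    exact this.hasMFDerivAt
  refine ⟨fun t => γ (c * t), ?_, fun t => h2 _, by simpa using h3, ?_⟩
  · have : ContMDiff 𝓘(ℝ, ℝ) 𝓘(ℝ, ℝ) 1 (fun t : ℝ => c * t) := by
      apply ContDiff.contMDiff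
      fun_prop
    exact h1.comp this
  · have hγ : HasMFDerivAt 𝓘(ℝ, ℝ) 𝓘(ℝ, E) γ (c * 0) (mfderiv 𝓘(ℝ, ℝ) 𝓘(ℝ, E) γ (c * 0)) :=
      ((h1 (c * 0)).mdifferentiableAt (by simp)).hasMFDerivAt
    have := (HasMFDerivAt.comp (x := (0 : ℝ)) (f := fun t : ℝ => c * t) hγ hl).mfderiv
    change mfderiv 𝓘(ℝ, ℝ) 𝓘(ℝ, E) (γ ∘ fun t : ℝ => c * t) 0 (1 : ℝ) = _
    rw [this, mul_zero]
    change (mfderiv 𝓘(ℝ, ℝ) 𝓘(ℝ, E) γ 0 : ℝ →L[ℝ] E) (c • (1 : ℝ)) = c • (v : E)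
    rw [← h4]
    exact (mfderiv 𝓘(ℝ, ℝ) 𝓘(ℝ, E) γ 0 : ℝ →L[ℝ] E).map_smul c 1

theorem IsVelocity.add [LieGroup 𝓘(ℝ, E) ∞ G] {H : Subgroup G}
    {v w : GroupLieAlgebra 𝓘(ℝ, E) G}
    (hv : IsVelocity H v) (hw : IsVelocity H w) : IsVelocity H (v + w) := by
  obtain ⟨γ, h1, h2, h3, h4⟩ := hv
  obtain ⟨δ, k1, k2, k3, k4⟩ := hw
  refine ⟨fun t => γ t * δ t, h1.mul k1, fun t => H.mul_mem (h2 t) (k2 t), by simp [h3, k3], ?_⟩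
  have hF : MDifferentiableAt (𝓘(ℝ, ℝ).prod 𝓘(ℝ, ℝ)) 𝓘(ℝ, E)
      (fun p : ℝ × ℝ => γ p.1 * δ p.2) ((0 : ℝ), (0 : ℝ)) :=
    (((h1.comp contMDiff_fst).mul (k1.comp contMDiff_snd)) _).mdifferentiableAt (by simp)
  have hd : HasMFDerivAt 𝓘(ℝ, ℝ) (𝓘(ℝ, ℝ).prod 𝓘(ℝ, ℝ)) (fun t : ℝ => (t, t)) 0
      ((ContinuousLinearMap.id ℝ ℝ).prod (ContinuousLinearMap.id ℝ ℝ)) :=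
    (hasMFDerivAt_id (0 : ℝ)).prodMk (hasMFDerivAt_id (0 : ℝ))
  have hc := (HasMFDerivAt.comp (x := (0 : ℝ)) (f := fun t : ℝ => (t, t)) hF.hasMFDerivAt hd).mfderiv
  change mfderiv 𝓘(ℝ, ℝ) 𝓘(ℝ, E) ((fun p : ℝ × ℝ => γ p.1 * δ p.2) ∘ fun t : ℝ => (t, t)) 0
    (1 : ℝ) = _
  rw [hc]
  refine (mfderiv_prod_eq_add_apply (v := ((1 : ℝ), (1 : ℝ))) hF).trans ?_
  have e1 : mfderiv 𝓘(ℝ, ℝ) 𝓘(ℝ, E) (fun z : ℝ => γ z * δ 0) 0 (1 : ℝ) = (v : E) := by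
    have : (fun z : ℝ => γ z * δ 0) = γ := by funext z; rw [k3, mul_one]
    rw [this]
    exact h4
  have e2 : mfderiv 𝓘(ℝ, ℝ) 𝓘(ℝ, E) (fun z : ℝ => γ 0 * δ z) 0 (1 : ℝ) = (w : E) := by
    have : (fun z : ℝ => γ 0 * δ z) = δ := by funext z; rw [h3, one_mul]
    rw [this]
    exact k4
  exact congrArg₂ (fun a b : E => a + b) e1 e2

/-- The Lie algebra `𝔥 ⊆ 𝔤` of a closed subgroup `H` of the Lie group `G`, as the tangent space
of `H` at `1`. -/
def tangentAlgebra [LieGroup 𝓘(ℝ, E) ∞ G] (H : Subgroup G) :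
    Submodule ℝ (GroupLieAlgebra 𝓘(ℝ, E) G) where
  carrier := {v | IsVelocity H v}
  zero_mem' := IsVelocity.zero H
  add_mem' := IsVelocity.add
  smul_mem' c _ hv := IsVelocity.smul c hv

/-- A torus in `G`: a subgroup isomorphic to `(S¹)ᵏ` for some `k`. (Continuous homomorphisms of Lie
groups are smooth, and the image of a compact group is closed.) -/
def IsTorus (S : Subgroup G) : Prop :=
  ∃ k : ℕ, Nonempty (S ≃ₜ* (Fin k → Circle))

/-- `G / H`, with `G` a compact connected Lie group, is a generalised flag manifold: `G` is
semisimple and `H` is the centraliser of a torus in `G`. -/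
structure IsGeneralisedFlagManifold (E : Type*) [NormedAddCommGroup E] [NormedSpace ℝ E]
    [CompleteSpace E] {G : Type*} [TopologicalSpace G] [ChartedSpace E G] [Group G]
    [LieGroup 𝓘(ℝ, E) ∞ G] (H : Subgroup G) : Prop where
  semisimple : LieAlgebra.IsSemisimple ℝ (GroupLieAlgebra 𝓘(ℝ, E) G)
  exists_torus : ∃ S : Subgroup G, IsTorus S ∧ H = Subgroup.centralizer (S : Set G)

/-- A Riemannian metric on `G` is bi-invariant if all left and all right translations are
isometries. -/
structure IsBiInvariant [LieGroup 𝓘(ℝ, E) ∞ G]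
    (g : Bundle.ContMDiffRiemannianMetric 𝓘(ℝ, E) ∞ E (TangentSpace 𝓘(ℝ, E) : G → Type _)) :
    Prop where
  left : ∀ (a x : G) (v w : TangentSpace 𝓘(ℝ, E) x),
    g.inner (a * x) (mfderiv 𝓘(ℝ, E) 𝓘(ℝ, E) (fun y : G => a * y) x v)
      (mfderiv 𝓘(ℝ, E) 𝓘(ℝ, E) (fun y : G => a * y) x w) = g.inner x v w
  right : ∀ (a x : G) (v w : TangentSpace 𝓘(ℝ, E) x),
    g.inner (x * a) (mfderiv 𝓘(ℝ, E) 𝓘(ℝ, E) (fun y : G => y * a) x v)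
      (mfderiv 𝓘(ℝ, E) 𝓘(ℝ, E) (fun y : G => y * a) x w) = g.inner x v w

/-- The scalar product on `𝔤` induced by a Riemannian metric on `G`. -/
def scalarProduct [LieGroup 𝓘(ℝ, E) ∞ G]
    (g : Bundle.ContMDiffRiemannianMetric 𝓘(ℝ, E) ∞ E (TangentSpace 𝓘(ℝ, E) : G → Type _)) :
    LinearMap.BilinForm ℝ (GroupLieAlgebra 𝓘(ℝ, E) G) :=
  LinearMap.mk₂ ℝ (fun v w => g.inner 1 v w)
    (fun _ _ _ => by simp) (fun _ _ _ => by simp) (fun _ _ _ => by simp) (fun _ _ _ => by simp)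

/-- `𝔳 ⊖ 𝔲`, the `Q`-orthogonal complement of `𝔲` in `𝔳`. -/
def ominus (Q : LinearMap.BilinForm ℝ (GroupLieAlgebra 𝓘(ℝ, E) G))
    (v u : Submodule ℝ (GroupLieAlgebra 𝓘(ℝ, E) G)) :
    Submodule ℝ (GroupLieAlgebra 𝓘(ℝ, E) G) :=
  v ⊓ Q.orthogonal u

/-- The subspace `u` of `𝔤` is `Ad(H)`-invariant. -/
def IsAdInvariant (H : Subgroup G) (u : Submodule ℝ (GroupLieAlgebra 𝓘(ℝ, E) G)) : Prop :=
  ∀ h ∈ H, ∀ x ∈ u, Ad h x ∈ u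

/-- The representations `Ad(H)|_u` and `Ad(H)|_v` on invariant subspaces are equivalent. -/
def AdEquivalent (H : Subgroup G) (u v : Submodule ℝ (GroupLieAlgebra 𝓘(ℝ, E) G)) : Prop :=
  ∃ f : u ≃ₗ[ℝ] v, ∀ h ∈ H, ∀ (x : u) (hx : Ad h (x : GroupLieAlgebra 𝓘(ℝ, E) G) ∈ u),
    (f ⟨Ad h (x : GroupLieAlgebra 𝓘(ℝ, E) G), hx⟩ : GroupLieAlgebra 𝓘(ℝ, E) G) =
      Ad h (f x : GroupLieAlgebra 𝓘(ℝ, E) G)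

/-- `u` is `Ad(H)`-invariant and `Ad(H)|_u` is irreducible. -/
def IsAdIrreducible (H : Subgroup G) (u : Submodule ℝ (GroupLieAlgebra 𝓘(ℝ, E) G)) : Prop :=
  IsAdInvariant H u ∧ u ≠ ⊥ ∧
    ∀ w : Submodule ℝ (GroupLieAlgebra 𝓘(ℝ, E) G), w ≤ u → IsAdInvariant H w → w = ⊥ ∨ w = u

/-- The space `𝔪 = 𝔤 ⊖ 𝔥`, on which `Ad(H)` acts by the isotropy representation of `G / H`. -/
def isotropySpace [LieGroup 𝓘(ℝ, E) ∞ G]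
    (Q : LinearMap.BilinForm ℝ (GroupLieAlgebra 𝓘(ℝ, E) G)) (H : Subgroup G) :
    Submodule ℝ (GroupLieAlgebra 𝓘(ℝ, E) G) :=
  ominus Q ⊤ (tangentAlgebra H)

/-- `𝔪 = 𝔪₁ ⊕ ⋯ ⊕ 𝔪ₛ` is a `Q`-orthogonal decomposition into irreducible `Ad(H)`-invariant
summands. -/
structure IsIsotropyDecomposition [LieGroup 𝓘(ℝ, E) ∞ G]
    (Q : LinearMap.BilinForm ℝ (GroupLieAlgebra 𝓘(ℝ, E) G)) (H : Subgroup G) {s : ℕ}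
    (m : Fin s → Submodule ℝ (GroupLieAlgebra 𝓘(ℝ, E) G)) : Prop where
  irreducible : ∀ i, IsAdIrreducible H (m i)
  orthogonal : ∀ i j, i ≠ j → ∀ x ∈ m i, ∀ y ∈ m j, Q x y = 0
  iSup_eq : ⨆ i, m i = isotropySpace Q H

/-- The two requirements on every Lie subalgebra `𝔰` of `𝔤` that contains `𝔥` properly:
`𝔰 ⊖ 𝔥` and `𝔤 ⊖ 𝔰` have no equivalent nonzero `Ad(H)`-invariant subspaces, and `[𝔯, 𝔰] ≠ 0` for
every `1`-dimensional `Ad(H)`-invariant subspace `𝔯` of `𝔤 ⊖ 𝔰`. -/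
def SubalgebraHypothesis [CompleteSpace E] [LieGroup 𝓘(ℝ, E) ∞ G]
    (Q : LinearMap.BilinForm ℝ (GroupLieAlgebra 𝓘(ℝ, E) G)) (H : Subgroup G) : Prop :=
  ∀ s : LieSubalgebra ℝ (GroupLieAlgebra 𝓘(ℝ, E) G), tangentAlgebra H < s.toSubmodule →
    (∀ u v : Submodule ℝ (GroupLieAlgebra 𝓘(ℝ, E) G),
      u ≠ ⊥ → v ≠ ⊥ → IsAdInvariant H u → IsAdInvariant H v →
      u ≤ ominus Q s.toSubmodule (tangentAlgebra H) → v ≤ ominus Q ⊤ s.toSubmodule →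
      ¬ AdEquivalent H u v) ∧
    (∀ r : Submodule ℝ (GroupLieAlgebra 𝓘(ℝ, E) G),
      Module.finrank ℝ r = 1 → IsAdInvariant H r → r ≤ ominus Q ⊤ s.toSubmodule →
      ∃ x ∈ r, ∃ y ∈ s, ⁅x, y⁆ ≠ 0)

end LieGroup

end FlagManifold

end

open FlagManifold

/-! Write 𝔷 for the set of `Ad(H)`-fixed vectors of 𝔥. Everything rests on one fact,
`mem_tangentAlgebra_of_lie_eq_zero`: the centraliser of 𝔷 in 𝔤 lies in 𝔥. An element s of S lies on
a one-parameter subgroup of S. Its adjoint action has a generator D, a derivation of 𝔤. The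
invariant scalar product and the trivial centre make the Killing form nondegenerate, so D = ad v;
the vector v is fixed by `Ad(H)` and lies in 𝔥. A vector commuting with 𝔷 is killed by D, hence
fixed by s; and 𝔥 is the space of vectors fixed by S.

Inequivalence (`no_equivariant_embedding`) is the one-dimensionality of root spaces in real form. A
maximal abelian subspace 𝔱 of 𝔥 contains 𝔷, so it is its own centraliser in 𝔤. An equivalence
between orthogonal subspaces of 𝔤, the first inside 𝔪, would give two orthogonal root planes for the
same root of 𝔱. The brackets between the planes that have weight zero vanish, and a sum of two
squared norms then comes out negative.

Parity (`IsAdIrreducible.even_finrank`): on an irreducible summand of 𝔪 some v in 𝔷 acts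
nontrivially. Since ad v commutes with `Ad(H)`, it is injective there; being also skew, it forces
even dimension. Hence 𝔪 contains no invariant line, and requirement (b) on subalgebras is vacuous.
-/

namespace LinearMap.BilinForm

/-! ### Symmetric and skew operators for a positive definite form -/

variable {V : Type*} [AddCommGroup V] [Module ℝ V] [FiniteDimensional ℝ V]

/-- A symmetric positive definite bilinear form, as an inner product. -/
abbrev innerProductCore (Q : LinearMap.BilinForm ℝ V) (hs : ∀ x y, Q x y = Q y x)
    (hp : ∀ x, x ≠ 0 → 0 < Q x x) : InnerProductSpace.Core ℝ V where
  inner x y := Q x y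
  conj_inner_symm x y := by simpa using hs y x
  re_inner_nonneg x := by
    rcases eq_or_ne x 0 with rfl | h
    · simp
    · simpa using (hp x h).le
  add_left x y z := by simp
  smul_left x y r := by simp
  definite x h := by
    by_contra hx
    exact (hp x hx).ne' h

/-- An operator that is symmetric for a positive definite form has a real eigenvector. -/
theorem exists_eigenvector_of_symmetric [Nontrivial V] (Q : LinearMap.BilinForm ℝ V)
    (hs : ∀ x y, Q x y = Q y x) (hp : ∀ x, x ≠ 0 → 0 < Q x x) (T : V →ₗ[ℝ] V)
    (hT : ∀ x y, Q (T x) y = Q x (T y)) : ∃ (c : ℝ) (x : V), x ≠ 0 ∧ T x = c • x := by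
  let core := innerProductCore Q hs hp
  let _ : NormedAddCommGroup V := core.toNormedAddCommGroup
  let _ : InnerProductSpace ℝ V := InnerProductSpace.ofCore core.toCore
  have hsym : T.IsSymmetric := hT
  obtain ⟨x, hx⟩ := hsym.hasEigenvalue_iSup_of_finiteDimensional.exists_hasEigenvector
  exact ⟨_, x, hx.2, hx.apply_eq_smul⟩

/-- A nonzero operator that is skew for a positive definite form has a square of nonzero trace. -/
theorem eq_zero_of_skew_of_trace_eq_zero (Q : LinearMap.BilinForm ℝ V)
    (hs : ∀ x y, Q x y = Q y x) (hp : ∀ x, x ≠ 0 → 0 < Q x x) (T : V →ₗ[ℝ] V)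
    (hT : ∀ x y, Q (T x) y = - Q x (T y)) (htr : LinearMap.trace ℝ V (T ∘ₗ T) = 0) : T = 0 := by
  let core := innerProductCore Q hs hp
  let _ : NormedAddCommGroup V := core.toNormedAddCommGroup
  let _ : InnerProductSpace ℝ V := InnerProductSpace.ofCore core.toCore
  have hnn : ∀ x, 0 ≤ Q x x := fun x => by
    rcases eq_or_ne x 0 with rfl | h
    · simp
    · exact (hp x h).le
  let b := stdOrthonormalBasis ℝ V
  rw [LinearMap.trace_eq_sum_inner _ b] at htr
  -- By skewness the trace of T² is minus the sum of the squared norms of the T bᵢ.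
  have h1 : ∀ i, inner ℝ (b i) ((T ∘ₗ T) (b i)) = - Q (T (b i)) (T (b i)) := by
    intro i
    change Q (b i) (T (T (b i))) = _
    rw [hT (b i) (T (b i)), neg_neg]
  rw [Finset.sum_congr rfl (fun i _ => h1 i), Finset.sum_neg_distrib, neg_eq_zero,
    Finset.sum_eq_zero_iff_of_nonneg (fun i _ => hnn _)] at htr
  refine b.toBasis.ext fun i => ?_
  by_contra hne
  have := hp (T (b i)) (by simpa using hne)
  rw [htr i (Finset.mem_univ _)] at this
  exact lt_irrefl _ this

/-- A space with an injective operator that is skew for a positive definite form has even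
dimension. -/
theorem even_finrank_of_skew (Q : LinearMap.BilinForm ℝ V) (hp : ∀ x, x ≠ 0 → 0 < Q x x)
    (T : V →ₗ[ℝ] V) (hT : ∀ x y, Q (T x) y = - Q x (T y)) (hinj : Function.Injective T) :
    Even (Module.finrank ℝ V) := by
  classical
  let b := Module.finBasis ℝ V
  let M := LinearMap.toMatrix b b T
  let B := LinearMap.BilinForm.toMatrix b Q
  have hnd : Q.Nondegenerate := by
    refine ⟨fun x hx => ?_, fun x hx => ?_⟩ <;>
    · by_contra h
      exact (hp x h).ne' (hx x)
  have hB : B.det ≠ 0 := (LinearMap.BilinForm.nondegenerate_iff_det_ne_zero b).1 hnd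
  have hM : M.det ≠ 0 := by
    rw [LinearMap.det_toMatrix]
    have := LinearEquiv.isUnit_det' (LinearEquiv.ofInjectiveEndo T hinj)
    exact this.ne_zero
  -- Skewness in matrix form. Taking determinants gives det M · det B = (-1)ⁿ det B · det M, which
  -- is impossible for odd n.
  have h : M.transpose * B = - (B * M) := by
    have h1 : Q.comp T LinearMap.id = - Q.comp LinearMap.id T := by
      ext x y
      simpa using hT x y
    have h2 := congrArg (LinearMap.BilinForm.toMatrix b) h1
    have h3 : LinearMap.BilinForm.toMatrix b (- Q.comp LinearMap.id T) =
        - LinearMap.BilinForm.toMatrix b (Q.comp LinearMap.id T) := by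
      ext i j
      simp [LinearMap.BilinForm.toMatrix_apply]
    rw [h3, LinearMap.BilinForm.toMatrix_comp b b, LinearMap.BilinForm.toMatrix_comp b b,
      LinearMap.toMatrix_id, Matrix.transpose_one, Matrix.one_mul, Matrix.mul_one] at h2
    exact h2
  have h3 := congrArg Matrix.det h
  rw [Matrix.det_mul, Matrix.det_transpose, Matrix.det_neg, Matrix.det_mul, Fintype.card_fin] at h3
  by_contra hodd
  rw [Nat.not_even_iff_odd] at hodd
  rw [hodd.neg_one_pow] at h3
  have : M.det * B.det = 0 := by linarith
  exact mul_ne_zero hM hB this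

end LinearMap.BilinForm

/-! ### Lie algebras with an invariant scalar product -/

section LieAlgebra

variable {L : Type*} [LieRing L] [LieAlgebra ℝ L] [FiniteDimensional ℝ L]

/-- A Lie algebra with trivial centre and an invariant scalar product has nondegenerate Killing
form. -/
theorem LieAlgebra.isKilling_of_invariant (Q : LinearMap.BilinForm ℝ L)
    (hs : ∀ x y, Q x y = Q y x) (hp : ∀ x, x ≠ 0 → 0 < Q x x)
    (hinv : ∀ x y z : L, Q ⁅x, y⁆ z = - Q y ⁅x, z⁆) (hc : LieAlgebra.center ℝ L = ⊥) :
    LieAlgebra.IsKilling ℝ L := by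
  refine ⟨(LieSubmodule.eq_bot_iff _).2 fun x hx => ?_⟩
  rw [LieIdeal.mem_killingCompl] at hx
  have h0 := hx x (LieSubmodule.mem_top x)
  rw [LieModule.traceForm_apply_apply] at h0
  have h1 : LieModule.toEnd ℝ L L x = 0 :=
    Q.eq_zero_of_skew_of_trace_eq_zero hs hp _ (hinv x) h0
  have h2 : x ∈ LieAlgebra.center ℝ L := by
    rw [LieModule.mem_maxTrivSubmodule]
    intro y
    rw [← lie_skew, neg_eq_zero]
    exact LinearMap.congr_fun h1 y
  rwa [hc] at h2

/-- Every subspace `h` contains an abelian subspace that is its own centraliser in `h`. -/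
theorem exists_maximal_abelian (h : Submodule ℝ L) :
    ∃ t : Submodule ℝ L, t ≤ h ∧ (∀ x ∈ t, ∀ y ∈ t, ⁅x, y⁆ = 0) ∧
      ∀ x ∈ h, (∀ y ∈ t, ⁅y, x⁆ = 0) → x ∈ t := by
  let A : Set (Submodule ℝ L) := {t | t ≤ h ∧ ∀ x ∈ t, ∀ y ∈ t, ⁅x, y⁆ = 0}
  have hA : A.Nonempty := ⟨⊥, bot_le, by simp⟩
  obtain ⟨t, ⟨ht, hab⟩, hmax⟩ := (wellFounded_gt (α := Submodule ℝ L)).has_min A hA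
  refine ⟨t, ht, hab, fun x hx hxt => ?_⟩
  by_contra hxn
  refine hmax (t ⊔ ℝ ∙ x) ⟨sup_le ht ((Submodule.span_singleton_le_iff_mem _ _).2 hx), ?_⟩ ?_
  · intro a ha b hb
    obtain ⟨a1, ha1, a2, ha2, rfl⟩ := Submodule.mem_sup.1 ha
    obtain ⟨b1, hb1, b2, hb2, rfl⟩ := Submodule.mem_sup.1 hb
    obtain ⟨c, rfl⟩ := Submodule.mem_span_singleton.1 ha2
    obtain ⟨d, rfl⟩ := Submodule.mem_span_singleton.1 hb2
    have : ⁅x, b1⁆ = 0 := by rw [← lie_skew, hxt b1 hb1, neg_zero]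
    simp [hab a1 ha1 b1 hb1, hxt a1 ha1, this]
  · refine lt_of_le_of_ne le_sup_left fun he => hxn ?_
    rw [he]
    exact Submodule.mem_sup_right (Submodule.mem_span_singleton_self x)

/-- A nonzero subspace invariant under an abelian subspace `t` on which `t` has no common kernel
contains a plane (spanned by `a` and `b`) on which `t` acts by infinitesimal rotations. -/
theorem exists_root_plane (Q : LinearMap.BilinForm ℝ L)
    (hs : ∀ x y, Q x y = Q y x) (hp : ∀ x, x ≠ 0 → 0 < Q x x)
    (hinv : ∀ x y z : L, Q ⁅x, y⁆ z = - Q y ⁅x, z⁆) (t u : Submodule ℝ L)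
    (hab : ∀ x ∈ t, ∀ y ∈ t, ⁅x, y⁆ = 0) (hu : u ≠ ⊥) (htu : ∀ x ∈ t, ∀ y ∈ u, ⁅x, y⁆ ∈ u)
    (hker : ∀ y ∈ u, (∀ x ∈ t, ⁅x, y⁆ = 0) → y = 0) :
    ∃ a ∈ u, ∃ b ∈ u, a ≠ 0 ∧ ∀ x ∈ t, ∃ c : ℝ, ⁅x, a⁆ = - c • b ∧ ⁅x, b⁆ = c • a := by
  let A : Set (Submodule ℝ L) := {w | w ≤ u ∧ w ≠ ⊥ ∧ ∀ x ∈ t, ∀ y ∈ w, ⁅x, y⁆ ∈ w}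
  obtain ⟨w, ⟨hwu, hw0, htw⟩, hmin⟩ :=
    (wellFounded_lt (α := Submodule ℝ L)).has_min A ⟨u, le_rfl, hu, htu⟩
  have hcomm : ∀ x ∈ t, ∀ y ∈ t, ∀ z : L, ⁅x, ⁅y, z⁆⁆ = ⁅y, ⁅x, z⁆⁆ := by
    intro x hx y hy z
    rw [leibniz_lie, hab x hx y hy, zero_lie, zero_add]
  -- Schur: symmetric operators commuting with `t` are scalar on `w`
  have schur : ∀ T : L →ₗ[ℝ] L, (∀ y ∈ w, T y ∈ w) → (∀ x y, Q (T x) y = Q x (T y)) →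
      (∀ x ∈ t, ∀ y : L, T ⁅x, y⁆ = ⁅x, T y⁆) → ∃ c : ℝ, ∀ y ∈ w, T y = c • y := by
    intro T hTw hTs hTt
    have : Nontrivial w := (Submodule.nontrivial_iff_ne_bot).2 hw0
    obtain ⟨c, ⟨y, hy⟩, hy0, hyc⟩ := LinearMap.BilinForm.exists_eigenvector_of_symmetric
      (Q.restrict w) (fun x y => hs x y) (fun x hx => hp x (by simpa using hx))
      (T.restrict hTw) (fun x y => hTs x y)
    refine ⟨c, ?_⟩
    -- The eigenspace in w is stable under t and nonzero, so minimality of w makes it all of w.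
    let w' := w ⊓ LinearMap.ker (T - c • LinearMap.id)
    have hw' : w' = w := by
      by_contra hne
      refine hmin w' ⟨inf_le_left.trans hwu, ?_, ?_⟩ (lt_of_le_of_ne inf_le_left hne)
      · intro hbot
        have : y ∈ w' := ⟨hy, by
          have := congrArg Subtype.val hyc
          simp only [LinearMap.restrict_apply] at this
          simp [this]⟩
        rw [hbot] at this
        exact hy0 (Subtype.ext this)
      · rintro x hx z ⟨hz1, hz2⟩
        refine ⟨htw x hx z hz1, ?_⟩
        have hz3 : T z = c • z := by simpa [sub_eq_zero] using hz2
        simp [hTt x hx, hz3]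
    intro z hz
    rw [← hw'] at hz
    simpa [sub_eq_zero] using hz.2
  obtain ⟨a, haw, ha0⟩ := (Submodule.ne_bot_iff _).1 hw0
  obtain ⟨x₀, hx₀, hx₀a⟩ : ∃ x ∈ t, ⁅x, a⁆ ≠ 0 := by
    by_contra hcon
    push Not at hcon
    exact ha0 (hker a (hwu haw) hcon)
  -- A product of two commuting skew operators is symmetric, so Schur applies to it although it does
  -- not apply to ad x itself.
  have key : ∀ x ∈ t, ∃ c : ℝ, ∀ y ∈ w, ⁅x, ⁅x₀, y⁆⁆ = c • y := by
    intro x hx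
    refine schur (LieAlgebra.ad ℝ L x ∘ₗ LieAlgebra.ad ℝ L x₀)
      (fun y hy => htw x hx _ (htw x₀ hx₀ y hy)) (fun y z => ?_) (fun z hz y => ?_)
    · change Q ⁅x, ⁅x₀, y⁆⁆ z = Q y ⁅x, ⁅x₀, z⁆⁆
      rw [hinv, hinv, neg_neg, hcomm x₀ hx₀ x hx]
    · change ⁅x, ⁅x₀, ⁅z, y⁆⁆⁆ = ⁅z, ⁅x, ⁅x₀, y⁆⁆⁆
      rw [hcomm x₀ hx₀ z hz, hcomm x hx z hz]
  obtain ⟨k, hk⟩ := key x₀ hx₀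
  have hk0 : k < 0 := by
    have h1 := hinv x₀ a ⁅x₀, a⁆
    rw [hk a haw, map_smul, smul_eq_mul] at h1
    have h2 := hp _ hx₀a
    have h3 := hp _ ha0
    by_contra hcon
    have : 0 ≤ k * Q a a := mul_nonneg (not_lt.1 hcon) h3.le
    linarith
  -- On w, ad x₀ squares to -r², so x₀ / r acts as a complex structure; b is the image of a under
  -- it.
  set r := Real.sqrt (-k) with hr
  have hr2 : r * r = -k := Real.mul_self_sqrt (by linarith)
  have hr0 : r ≠ 0 := (Real.sqrt_pos.2 (by linarith)).ne'
  refine ⟨a, hwu haw, r⁻¹ • ⁅x₀, a⁆, hwu (w.smul_mem _ (htw x₀ hx₀ a haw)), ha0, ?_⟩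
  intro x hx
  obtain ⟨c, hc⟩ := key x hx
  refine ⟨r⁻¹ * c, ?_, ?_⟩
  · have h1 : ⁅x₀, ⁅x₀, ⁅x, a⁆⁆⁆ = k • ⁅x, a⁆ := hk _ (htw x hx a haw)
    rw [← hcomm x hx x₀ hx₀, hc a haw, lie_smul] at h1
    have h2 : ⁅x, a⁆ = k⁻¹ • c • ⁅x₀, a⁆ := by
      rw [h1, smul_smul, inv_mul_cancel₀ hk0.ne, one_smul]
    rw [h2, smul_smul, smul_smul]
    congr 1
    have : k = - (r * r) := by linarith
    rw [this]
    field_simp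
  · rw [lie_smul, hc a haw, smul_smul]

/-- Let `h` be a subspace containing the centraliser of a set of elements of `h` commuting with `h`.
Then orthogonal subspaces of the complement of `h` are not isomorphic as `h`-modules. -/
theorem no_equivariant_embedding (Q : LinearMap.BilinForm ℝ L)
    (hs : ∀ x y, Q x y = Q y x) (hp : ∀ x, x ≠ 0 → 0 < Q x x)
    (hinv : ∀ x y z : L, Q ⁅x, y⁆ z = - Q y ⁅x, z⁆) (h : Submodule ℝ L) (z : Set L)
    (hzh : z ⊆ h) (hz : ∀ x ∈ z, ∀ y ∈ h, ⁅x, y⁆ = 0)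
    (hcent : ∀ x, (∀ y ∈ z, ⁅y, x⁆ = 0) → x ∈ h)
    (u v : Submodule ℝ L) (hu : u ≠ ⊥) (hhu : ∀ x ∈ h, ∀ y ∈ u, ⁅x, y⁆ ∈ u)
    (huh : ∀ x ∈ h, ∀ y ∈ u, Q x y = 0) (huv : ∀ x ∈ u, ∀ y ∈ v, Q x y = 0)
    (f : u →ₗ[ℝ] v) (hf : Function.Injective f)
    (hfh : ∀ x ∈ h, ∀ (y : u) (hy : ⁅x, (y : L)⁆ ∈ u), (f ⟨⁅x, (y : L)⁆, hy⟩ : L) = ⁅x, (f y : L)⁆) :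
    False := by
  obtain ⟨t, hth, hab, hmax⟩ := exists_maximal_abelian h
  -- z is central in h, so maximality puts it in t. Anything commuting with t then commutes with z,
  -- lies in h, and so lies in t.
  have hzt : ∀ x ∈ z, x ∈ t := fun x hx => hmax x (hzh hx) fun y hy => by
    rw [← lie_skew, hz x hx y (hth hy), neg_zero]
  have hct : ∀ x, (∀ y ∈ t, ⁅y, x⁆ = 0) → x ∈ t := fun x hx =>
    hmax x (hcent x fun y hy => hx y (hzt y hy)) hx
  obtain ⟨a, ha, b, hb, ha0, hroot⟩ := exists_root_plane Q hs hp hinv t u hab hu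
    (fun x hx => hhu x (hth hx)) (fun y hy hxy => by
      by_contra hy0
      exact (hp y hy0).ne' (huh y (hth (hct y hxy)) y hy))
  set a' : L := (f ⟨a, ha⟩ : L) with ha'
  set b' : L := (f ⟨b, hb⟩ : L) with hb'
  have ha'v : a' ∈ v := (f ⟨a, ha⟩).2
  have hb'v : b' ∈ v := (f ⟨b, hb⟩).2
  have ha'0 : a' ≠ 0 := by
    intro h0
    have : f ⟨a, ha⟩ = 0 := Subtype.ext h0
    rw [← map_zero f] at this
    exact ha0 (congrArg Subtype.val (hf this))
  have hroot' : ∀ x ∈ t, ∀ c : ℝ, ⁅x, a⁆ = - c • b → ⁅x, b⁆ = c • a →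
      ⁅x, a'⁆ = - c • b' ∧ ⁅x, b'⁆ = c • a' := by
    intro x hx c h1 h2
    constructor
    · rw [ha', ← hfh x (hth hx) ⟨a, ha⟩ (hhu x (hth hx) a ha), hb', ← Submodule.coe_smul,
        ← map_smul]
      congr 3
    · rw [hb', ← hfh x (hth hx) ⟨b, hb⟩ (hhu x (hth hx) b hb), ha', ← Submodule.coe_smul,
        ← map_smul]
      congr 3
  -- A weight-zero vector orthogonal to t vanishes.
  have eq_zero : ∀ x, (∀ y ∈ t, ⁅y, x⁆ = 0) → (∀ y ∈ t, Q x y = 0) → x = 0 := by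
    intro x h1 h2
    by_contra hx
    exact (hp x hx).ne' (h2 x (hct x h1))
  have Qswap : ∀ x y w, Q ⁅x, y⁆ w = Q y ⁅w, x⁆ := by
    intro x y w
    rw [hinv, ← lie_skew x w, map_neg, neg_neg]
  -- With A = a + ib and A' = a' + ib' of equal weight, the bracket of A with the conjugate of A'
  -- has weight zero. It is orthogonal to t because u ⟂ v. `hP` and `hR` are the vanishing of its
  -- real and imaginary parts.
  have hP : ⁅a, a'⁆ + ⁅b, b'⁆ = 0 := by
    refine eq_zero _ (fun y hy => ?_) (fun y hy => ?_) <;>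
      obtain ⟨c, h1, h2⟩ := hroot y hy <;> obtain ⟨h3, h4⟩ := hroot' y hy c h1 h2
    · rw [lie_add, leibniz_lie, leibniz_lie y b, h1, h2, h3, h4]
      simp only [smul_lie, lie_smul, neg_smul, neg_lie, lie_neg]
      abel
    · rw [map_add, LinearMap.add_apply, Qswap, Qswap, h1, h2, map_smul, map_smul, hs a', hs b',
        huv b hb a' ha'v, huv a ha b' hb'v]
      simp
  have hR : ⁅a, b'⁆ - ⁅b, a'⁆ = 0 := by
    refine eq_zero _ (fun y hy => ?_) (fun y hy => ?_) <;>
      obtain ⟨c, h1, h2⟩ := hroot y hy <;> obtain ⟨h3, h4⟩ := hroot' y hy c h1 h2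
    · rw [lie_sub, leibniz_lie, leibniz_lie y b, h1, h2, h3, h4]
      simp only [smul_lie, lie_smul, neg_smul, neg_lie, lie_neg]
      abel
    · rw [map_sub, LinearMap.sub_apply, Qswap, Qswap, h1, h2, map_smul, map_smul, hs a', hs b',
        huv a ha a' ha'v, huv b hb b' hb'v]
      simp
  -- Up to scale e is the coroot: pairing with it recovers the root, so e ≠ 0 and the root has a
  -- strict sign on e.
  set e : L := ⁅a, b⁆ with he
  have het : e ∈ t := by
    refine hct _ fun y hy => ?_
    obtain ⟨c, h1, h2⟩ := hroot y hy
    rw [he, leibniz_lie, h1, h2]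
    simp
  have hQe : ∀ x ∈ t, ∀ c : ℝ, ⁅x, b⁆ = c • a → Q e x = - (c * Q a a) := by
    intro x hx c h2
    rw [he, ← lie_skew, map_neg, LinearMap.neg_apply, Qswap, h2, map_smul, smul_eq_mul]
  have he0 : e ≠ 0 := by
    intro h0
    have hall : ∀ x ∈ t, ⁅x, a⁆ = 0 := by
      intro x hx
      obtain ⟨c, h1, h2⟩ := hroot x hx
      have := hQe x hx c h2
      rw [h0] at this
      simp only [map_zero, LinearMap.zero_apply, zero_eq_neg, mul_eq_zero] at this
      rw [h1, this.resolve_right (hp a ha0).ne']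
      simp
    exact (hp a ha0).ne' (huh a (hth (hct a hall)) a ha)
  obtain ⟨c, h1, h2⟩ := hroot e het
  obtain ⟨h3, h4⟩ := hroot' e het c h1 h2
  have hc : c < 0 := by
    have h5 := hQe e het c h2
    have h6 := hp e he0
    have h7 := hp a ha0
    by_contra hcon
    have : 0 ≤ c * Q a a := mul_nonneg (not_lt.1 hcon) h7.le
    linarith
  have hR' : ⁅b, a'⁆ = ⁅a, b'⁆ := (sub_eq_zero.1 hR).symm
  have hP' : ⁅a, a'⁆ = - ⁅b, b'⁆ := eq_neg_of_add_eq_zero_left hP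
  -- Move one a across Q, replace ⁅a, a'⁆ by -⁅b, b'⁆, and use Jacobi; the term ⁅e, b'⁆ = c a'
  -- leaves a negative multiple of the squared norm of a'.
  have h8 : Q ⁅a, a'⁆ ⁅a, a'⁆ + Q ⁅b, a'⁆ ⁅b, a'⁆ = c * Q a' a' := by
    rw [hinv a a', hinv b a', hP', lie_neg, leibniz_lie a b b', ← hR', ← he, h4]
    simp only [map_neg, neg_neg, map_add, map_smul, smul_eq_mul]
    ring
  have hnn : ∀ x, 0 ≤ Q x x := fun x => by
    rcases eq_or_ne x 0 with rfl | h
    · simp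
    · exact (hp x h).le
  have := hnn ⁅a, a'⁆
  have := hnn ⁅b, a'⁆
  have := mul_neg_of_neg_of_pos hc (hp a' ha'0)
  linarith

end LieAlgebra

open scoped Topology
open VectorField

noncomputable section

namespace FlagManifold

/-! ### Smoothness of Ad at the identity, and the multiplication in a chart -/

section Adjoint

variable {E : Type*} [NormedAddCommGroup E] [NormedSpace ℝ E]
  {G : Type*} [TopologicalSpace G] [ChartedSpace E G] [Group G]

theorem Ad_one : Ad (E := E) (1 : G) = ContinuousLinearMap.id ℝ _ := by
  have : (fun x : G => 1 * x * 1⁻¹) = id := by ext x; simp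
  unfold Ad
  rw [this]
  exact mfderiv_id

variable [LieGroup 𝓘(ℝ, E) ∞ G]

theorem contMDiff_conj (g : G) :
    ContMDiff 𝓘(ℝ, E) 𝓘(ℝ, E) ∞ (fun x : G => g * x * g⁻¹) :=
  (contMDiff_const.mul contMDiff_id).mul contMDiff_const

theorem hasMFDerivAt_conj (g : G) :
    HasMFDerivAt 𝓘(ℝ, E) 𝓘(ℝ, E) (fun x : G => g * x * g⁻¹) 1 (Ad (E := E) g) :=
  ((contMDiff_conj g 1).mdifferentiableAt (by simp)).hasMFDerivAt

theorem Ad_mul (g h : G) : Ad (E := E) (g * h) = (Ad g).comp (Ad h) := by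
  have h1 : (fun x : G => g * h * x * (g * h)⁻¹) =
      (fun x : G => g * x * g⁻¹) ∘ fun x : G => h * x * h⁻¹ := by
    ext x
    simp [mul_assoc]
  have h2 : HasMFDerivAt 𝓘(ℝ, E) 𝓘(ℝ, E) (fun x : G => g * x * g⁻¹) (h * 1 * h⁻¹)
      (Ad (E := E) g : E →L[ℝ] E) := by
    have : h * 1 * h⁻¹ = 1 := by simp
    rw [this]
    exact hasMFDerivAt_conj g
  unfold Ad
  rw [h1]
  exact (h2.comp 1 (hasMFDerivAt_conj h)).mfderiv

/-- The adjoint representation, read in the model vector space. -/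
def adE (g : G) : E →L[ℝ] E := Ad (E := E) g

omit [LieGroup 𝓘(ℝ, E) ∞ G] in
theorem adE_one : adE (E := E) (1 : G) = ContinuousLinearMap.id ℝ E := Ad_one

theorem adE_mul (g h : G) : adE (E := E) (g * h) = (adE g).comp (adE h) := Ad_mul g h

/-- The differential of a smooth family of maps depends smoothly on the parameter. Conjugations fix
1, so the tangent coordinate changes involved are all trivial. -/
theorem contMDiffAt_adE :
    ContMDiffAt 𝓘(ℝ, E) 𝓘(ℝ, E →L[ℝ] E) 1 (adE (E := E) (G := G)) 1 := by
  have : IsManifold 𝓘(ℝ, E) 1 G := IsManifold.of_le (n := ∞) (by simp)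
  have h1 : ContMDiff (𝓘(ℝ, E).prod 𝓘(ℝ, E)) 𝓘(ℝ, E) ∞
      (Function.uncurry fun g x : G => g * x * g⁻¹) :=
    (contMDiff_fst.mul contMDiff_snd).mul contMDiff_fst.inv
  have h2 := ContMDiffAt.mfderiv (x₀ := (1 : G)) (n := ∞) (m := 1) (fun g x : G => g * x * g⁻¹)
    (fun _ => (1 : G)) (h1 _) contMDiffAt_const (by
      rw [one_add_one_eq_two]
      exact ENat.LEInfty.out)
  refine h2.congr_of_eventuallyEq (Filter.Eventually.of_forall fun g => ?_)
  have h3 := inTangentCoordinates_eq (I := 𝓘(ℝ, E)) (I' := 𝓘(ℝ, E)) (fun _ : G => (1 : G))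
    (fun x : G => x * 1 * x⁻¹)
    (fun x : G => (mfderiv 𝓘(ℝ, E) 𝓘(ℝ, E) (fun y : G => x * y * x⁻¹) 1 : E →L[ℝ] E))
    (x₀ := (1 : G)) (x := g) (by simp) (by simp)
  refine Eq.trans ?_ h3.symm
  ext v
  have h4 : ∀ w : E, (tangentBundleCore 𝓘(ℝ, E) G).coordChange (achart E (1 : G))
      (achart E (1 : G)) 1 w = w := fun w =>
    (tangentBundleCore 𝓘(ℝ, E) G).coordChange_self _ _ (by simp) w
  simp only [mul_one, mul_inv_cancel, ContinuousLinearMap.comp_apply, h4]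
  exact (congrArg (adE g) (h4 v)).symm

/-- Multiplicativity of Ad transports continuity from 1 to any g. -/
theorem continuous_adE : Continuous (adE (E := E) (G := G)) := by
  have := topologicalGroup_of_lieGroup 𝓘(ℝ, E) ∞ (G := G)
  rw [continuous_iff_continuousAt]
  intro g
  have h1 : adE (E := E) (G := G) = fun x => (adE g).comp (adE (g⁻¹ * x)) := by
    funext x
    rw [← adE_mul, mul_inv_cancel_left]
  rw [h1]
  have h2 : ContinuousAt (fun x : G => adE (E := E) (g⁻¹ * x)) g := by
    refine ContinuousAt.comp (f := fun x : G => g⁻¹ * x) ?_ (by fun_prop)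
    rw [inv_mul_cancel]
    exact contMDiffAt_adE.continuousAt
  exact ((ContinuousLinearMap.compL ℝ E E E (adE g)).continuous.continuousAt).comp h2

/-- The multiplication of `G`, read in the chart at the identity. -/
def chartMul (p : E × E) : E :=
  extChartAt 𝓘(ℝ, E) (1 : G) ((extChartAt 𝓘(ℝ, E) (1 : G)).symm p.1 *
    (extChartAt 𝓘(ℝ, E) (1 : G)).symm p.2)

theorem hasMFDerivAt_extChartAt_symm_one :
    HasMFDerivAt 𝓘(ℝ, E) 𝓘(ℝ, E) (extChartAt 𝓘(ℝ, E) (1 : G)).symm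
      (extChartAt 𝓘(ℝ, E) (1 : G) 1) (ContinuousLinearMap.id ℝ E) := by
  have : IsManifold 𝓘(ℝ, E) 1 G := IsManifold.of_le (n := ∞) (by simp)
  have h1 := mdifferentiableWithinAt_extChartAt_symm (I := 𝓘(ℝ, E)) (mem_extChartAt_target (1 : G))
  have h2 : HasMFDerivWithinAt 𝓘(ℝ, E) 𝓘(ℝ, E) (extChartAt 𝓘(ℝ, E) (1 : G)).symm
      (Set.range 𝓘(ℝ, E)) (extChartAt 𝓘(ℝ, E) (1 : G) 1)
      (mfderivWithin 𝓘(ℝ, E) 𝓘(ℝ, E) (extChartAt 𝓘(ℝ, E) (1 : G)).symm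
        (Set.range 𝓘(ℝ, E)) (extChartAt 𝓘(ℝ, E) (1 : G) 1) : E →L[ℝ] E) := h1.hasMFDerivWithinAt
  have h3 : (mfderivWithin 𝓘(ℝ, E) 𝓘(ℝ, E) (extChartAt 𝓘(ℝ, E) (1 : G)).symm
        (Set.range 𝓘(ℝ, E)) (extChartAt 𝓘(ℝ, E) (1 : G) 1) : E →L[ℝ] E) =
      ContinuousLinearMap.id ℝ E := mfderivWithin_range_extChartAt_symm
  rw [ModelWithCorners.range_eq_univ] at h2 h3
  exact hasMFDerivWithinAt_univ.1 (h3 ▸ h2)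

theorem contMDiffAt_extChartAt_symm {p : E} (hp : p ∈ (extChartAt 𝓘(ℝ, E) (1 : G)).target) :
    ContMDiffAt 𝓘(ℝ, E) 𝓘(ℝ, E) ∞ (extChartAt 𝓘(ℝ, E) (1 : G)).symm p := by
  have : IsManifold 𝓘(ℝ, E) ∞ G := inferInstance
  exact (contMDiffOn_extChartAt_symm (1 : G)).contMDiffAt
    ((isOpen_extChartAt_target (1 : G)).mem_nhds hp)

theorem contDiffAt_chartMul :
    ContDiffAt ℝ ∞ (chartMul (E := E) (G := G))
      (extChartAt 𝓘(ℝ, E) (1 : G) 1, extChartAt 𝓘(ℝ, E) (1 : G) 1) := by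
  have hs := contMDiffAt_extChartAt_symm (mem_extChartAt_target (I := 𝓘(ℝ, E)) (1 : G))
  have h1 : ContMDiffAt (𝓘(ℝ, E).prod 𝓘(ℝ, E)) 𝓘(ℝ, E) ∞
      (fun p : E × E => (extChartAt 𝓘(ℝ, E) (1 : G)).symm p.1 *
        (extChartAt 𝓘(ℝ, E) (1 : G)).symm p.2)
      (extChartAt 𝓘(ℝ, E) (1 : G) 1, extChartAt 𝓘(ℝ, E) (1 : G) 1) :=
    (hs.comp_of_eq contMDiffAt_fst rfl).mul (hs.comp_of_eq contMDiffAt_snd rfl)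
  have h2 : ContMDiffAt (𝓘(ℝ, E).prod 𝓘(ℝ, E)) 𝓘(ℝ, E) ∞ (chartMul (E := E) (G := G))
      (extChartAt 𝓘(ℝ, E) (1 : G) 1, extChartAt 𝓘(ℝ, E) (1 : G) 1) :=
    ContMDiffAt.comp_of_eq (contMDiffAt_extChartAt (x := (1 : G))) h1 (by simp)
  rw [← modelWithCornersSelf_prod, chartedSpaceSelf_prod] at h2
  exact h2.contDiffAt

theorem contMDiff_mulLeft (g : G) : ContMDiff 𝓘(ℝ, E) 𝓘(ℝ, E) ∞ (fun x : G => g * x) :=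
  contMDiff_const.mul contMDiff_id

theorem contMDiff_mulRight (g : G) : ContMDiff 𝓘(ℝ, E) 𝓘(ℝ, E) ∞ (fun x : G => x * g) :=
  contMDiff_id.mul contMDiff_const

/-- The differential of the chart at the identity. -/
def chartDeriv (g : G) : E →L[ℝ] E := mfderiv 𝓘(ℝ, E) 𝓘(ℝ, E) (extChartAt 𝓘(ℝ, E) (1 : G)) g

/-- The differential at the identity of a left translation. -/
def leftDeriv (g : G) : E →L[ℝ] E := mfderiv 𝓘(ℝ, E) 𝓘(ℝ, E) (fun x : G => g * x) 1

/-- The differential at the identity of a right translation. -/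
def rightDeriv (g : G) : E →L[ℝ] E := mfderiv 𝓘(ℝ, E) 𝓘(ℝ, E) (fun x : G => x * g) 1

theorem hasMFDerivAt_mulLeft (g : G) {h : G} (hh : h = 1) :
    HasMFDerivAt 𝓘(ℝ, E) 𝓘(ℝ, E) (fun x : G => g * x) h (leftDeriv (E := E) g) := by
  subst hh
  exact ((contMDiff_mulLeft g 1).mdifferentiableAt (by simp)).hasMFDerivAt

theorem hasMFDerivAt_mulRight (g : G) {h : G} (hh : h = 1) :
    HasMFDerivAt 𝓘(ℝ, E) 𝓘(ℝ, E) (fun x : G => x * g) h (rightDeriv (E := E) g) := by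
  subst hh
  exact ((contMDiff_mulRight g 1).mdifferentiableAt (by simp)).hasMFDerivAt

theorem hasMFDerivAt_extChartAt_one {g h : G} (hg : g ∈ (chartAt E (1 : G)).source) (hh : h = g) :
    HasMFDerivAt 𝓘(ℝ, E) 𝓘(ℝ, E) (extChartAt 𝓘(ℝ, E) (1 : G)) h (chartDeriv (E := E) g) := by
  have : IsManifold 𝓘(ℝ, E) 1 G := IsManifold.of_le (n := ∞) (by simp)
  subst hh
  exact (mdifferentiableAt_extChartAt hg).hasMFDerivAt

/-- Differentiate gx = (gxg⁻¹)g. This identity is what brings Ad into the chart computation of the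
bracket. -/
theorem rightDeriv_comp_adE (g : G) :
    (rightDeriv (E := E) g).comp (adE g) = leftDeriv g := by
  have h1 : (fun x : G => g * x) = (fun x : G => x * g) ∘ fun x : G => g * x * g⁻¹ := by
    ext x
    simp
  have h2 := (hasMFDerivAt_mulRight (E := E) g (h := g * 1 * g⁻¹) (by simp)).comp 1
    (hasMFDerivAt_conj g)
  rw [← h1] at h2
  exact h2.mfderiv.symm

omit [LieGroup 𝓘(ℝ, E) ∞ G] in
theorem extChartAt_symm_mem_source {p : E} (hp : p ∈ (extChartAt 𝓘(ℝ, E) (1 : G)).target) :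
    (extChartAt 𝓘(ℝ, E) (1 : G)).symm p ∈ (chartAt E (1 : G)).source := by
  rw [← extChartAt_source 𝓘(ℝ, E)]
  exact (extChartAt 𝓘(ℝ, E) (1 : G)).map_target hp

theorem hasFDerivAt_chartMul_right {p : E} (hp : p ∈ (extChartAt 𝓘(ℝ, E) (1 : G)).target) :
    HasFDerivAt (fun q => chartMul (G := G) (p, q))
      ((chartDeriv ((extChartAt 𝓘(ℝ, E) (1 : G)).symm p)).comp
        (leftDeriv ((extChartAt 𝓘(ℝ, E) (1 : G)).symm p)))
      (extChartAt 𝓘(ℝ, E) (1 : G) 1) := by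
  set g := (extChartAt 𝓘(ℝ, E) (1 : G)).symm p
  have h1 := (hasMFDerivAt_mulLeft (E := E) g (extChartAt_to_inv (I := 𝓘(ℝ, E)) (1 : G))).comp _
    (hasMFDerivAt_extChartAt_symm_one (E := E) (G := G))
  have h2 := (hasMFDerivAt_extChartAt_one (extChartAt_symm_mem_source hp)
    (h := g * (extChartAt 𝓘(ℝ, E) (1 : G)).symm (extChartAt 𝓘(ℝ, E) (1 : G) 1))
    (by simp [g])).comp (f := (fun x : G => g * x) ∘ (extChartAt 𝓘(ℝ, E) (1 : G)).symm) _ h1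
  exact h2.hasFDerivAt

theorem hasFDerivAt_chartMul_left {p : E} (hp : p ∈ (extChartAt 𝓘(ℝ, E) (1 : G)).target) :
    HasFDerivAt (fun q => chartMul (G := G) (q, p))
      ((chartDeriv ((extChartAt 𝓘(ℝ, E) (1 : G)).symm p)).comp
        (rightDeriv ((extChartAt 𝓘(ℝ, E) (1 : G)).symm p)))
      (extChartAt 𝓘(ℝ, E) (1 : G) 1) := by
  set g := (extChartAt 𝓘(ℝ, E) (1 : G)).symm p
  have h1 := (hasMFDerivAt_mulRight (E := E) g (extChartAt_to_inv (I := 𝓘(ℝ, E)) (1 : G))).comp _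
    (hasMFDerivAt_extChartAt_symm_one (E := E) (G := G))
  have h2 := (hasMFDerivAt_extChartAt_one (extChartAt_symm_mem_source hp)
    (h := (extChartAt 𝓘(ℝ, E) (1 : G)).symm (extChartAt 𝓘(ℝ, E) (1 : G) 1) * g)
    (by simp [g])).comp (f := (fun x : G => x * g) ∘ (extChartAt 𝓘(ℝ, E) (1 : G)).symm) _ h1
  exact h2.hasFDerivAt

end Adjoint

/-! ### The differential of Ad is ad -/

section AdjointDeriv

variable {E : Type*} [NormedAddCommGroup E] [NormedSpace ℝ E]
  {G : Type*} [TopologicalSpace G] [ChartedSpace E G] [Group G] [LieGroup 𝓘(ℝ, E) ∞ G]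

/-- The second derivative of the multiplication at the identity, read in the chart. -/
def chartHess (G : Type*) [TopologicalSpace G] [ChartedSpace E G] [Group G] :
    E × E →L[ℝ] E × E →L[ℝ] E :=
  fderiv ℝ (fderiv ℝ (chartMul (E := E) (G := G)))
    (extChartAt 𝓘(ℝ, E) (1 : G) 1, extChartAt 𝓘(ℝ, E) (1 : G) 1)

theorem hasFDerivAt_fderiv_chartMul :
    HasFDerivAt (fderiv ℝ (chartMul (E := E) (G := G))) (chartHess G)
      (extChartAt 𝓘(ℝ, E) (1 : G) 1, extChartAt 𝓘(ℝ, E) (1 : G) 1) :=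
  ((contDiffAt_chartMul.fderiv_right (m := 1) (by
    rw [one_add_one_eq_two]; exact ENat.LEInfty.out)).differentiableAt (by simp)).hasFDerivAt

theorem chartHess_symm (x y : E × E) : chartHess G x y = chartHess G y x :=
  (contDiffAt_chartMul (E := E) (G := G)).isSymmSndFDerivAt (by
    rw [minSmoothness_of_isRCLikeNormedField]; exact ENat.LEInfty.out) x y

theorem eventually_differentiableAt_chartMul :
    ∀ᶠ p in 𝓝 (extChartAt 𝓘(ℝ, E) (1 : G) 1, extChartAt 𝓘(ℝ, E) (1 : G) 1),
      DifferentiableAt ℝ (chartMul (E := E) (G := G)) p := by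
  have h := (contDiffAt_chartMul (E := E) (G := G)).of_le (m := 1) (by simp)
  filter_upwards [h.eventually (by simp)] with p hp
  exact hp.differentiableAt (by simp)

omit [LieGroup 𝓘(ℝ, E) ∞ G] in
theorem eventually_mem_target :
    ∀ᶠ p in 𝓝 (extChartAt 𝓘(ℝ, E) (1 : G) 1), p ∈ (extChartAt 𝓘(ℝ, E) (1 : G)).target :=
  (isOpen_extChartAt_target (1 : G)).mem_nhds (mem_extChartAt_target (1 : G))

theorem eventually_fderiv_chartMul_inr :
    ∀ᶠ p in 𝓝 (extChartAt 𝓘(ℝ, E) (1 : G) 1), ∀ x : E,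
      fderiv ℝ (chartMul (E := E) (G := G)) (p, extChartAt 𝓘(ℝ, E) (1 : G) 1) (0, x) =
        chartDeriv ((extChartAt 𝓘(ℝ, E) (1 : G)).symm p)
          (leftDeriv ((extChartAt 𝓘(ℝ, E) (1 : G)).symm p) x) := by
  set c := extChartAt 𝓘(ℝ, E) (1 : G) 1 with hc
  have hcont : Filter.Tendsto (fun p : E => (p, c)) (𝓝 c) (𝓝 (c, c)) :=
    (continuous_id.prodMk continuous_const).tendsto c
  filter_upwards [hcont.eventually (eventually_differentiableAt_chartMul (E := E) (G := G)),
    eventually_mem_target (E := E) (G := G)] with p h1 h2 x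
  have h3 : HasFDerivAt (fun q : E => (p, q)) (ContinuousLinearMap.inr ℝ E E) c :=
    hasFDerivAt_prodMk_right p c
  have h4 := h1.hasFDerivAt.comp c h3
  have h5 := h4.unique (hasFDerivAt_chartMul_right h2)
  exact DFunLike.congr_fun h5 x

theorem eventually_fderiv_chartMul_inl :
    ∀ᶠ p in 𝓝 (extChartAt 𝓘(ℝ, E) (1 : G) 1), ∀ x : E,
      fderiv ℝ (chartMul (E := E) (G := G)) (extChartAt 𝓘(ℝ, E) (1 : G) 1, p) (x, 0) =
        chartDeriv ((extChartAt 𝓘(ℝ, E) (1 : G)).symm p)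
          (rightDeriv ((extChartAt 𝓘(ℝ, E) (1 : G)).symm p) x) := by
  set c := extChartAt 𝓘(ℝ, E) (1 : G) 1 with hc
  have hcont : Filter.Tendsto (fun p : E => (c, p)) (𝓝 c) (𝓝 (c, c)) :=
    (continuous_const.prodMk continuous_id).tendsto c
  filter_upwards [hcont.eventually (eventually_differentiableAt_chartMul (E := E) (G := G)),
    eventually_mem_target (E := E) (G := G)] with p h1 h2 x
  have h3 : HasFDerivAt (fun q : E => (q, p)) (ContinuousLinearMap.inl ℝ E E) c :=
    hasFDerivAt_prodMk_left c p
  have h4 := h1.hasFDerivAt.comp c h3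
  have h5 := h4.unique (hasFDerivAt_chartMul_left h2)
  exact DFunLike.congr_fun h5 x

theorem chartDeriv_one : chartDeriv (E := E) (1 : G) = ContinuousLinearMap.id ℝ E := by
  have : IsManifold 𝓘(ℝ, E) 1 G := IsManifold.of_le (n := ∞) (by simp)
  exact mfderiv_extChartAt_self

omit [LieGroup 𝓘(ℝ, E) ∞ G] in
theorem leftDeriv_one : leftDeriv (E := E) (1 : G) = ContinuousLinearMap.id ℝ E := by
  unfold leftDeriv
  have : (fun x : G => 1 * x) = id := by ext x; simp
  rw [this]
  exact mfderiv_id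

omit [LieGroup 𝓘(ℝ, E) ∞ G] in
theorem rightDeriv_one : rightDeriv (E := E) (1 : G) = ContinuousLinearMap.id ℝ E := by
  unfold rightDeriv
  have : (fun x : G => x * 1) = id := by ext x; simp
  rw [this]
  exact mfderiv_id

theorem hasFDerivAt_fderiv_chartMul_inr (x : E) :
    HasFDerivAt (fun p => fderiv ℝ (chartMul (E := E) (G := G))
      (p, extChartAt 𝓘(ℝ, E) (1 : G) 1) (0, x))
      (((chartHess G).comp (ContinuousLinearMap.inl ℝ E E)).flip (0, x))
      (extChartAt 𝓘(ℝ, E) (1 : G) 1) := by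
  set c := extChartAt 𝓘(ℝ, E) (1 : G) 1 with hc
  have h := HasFDerivAt.comp c (f := fun p : E => (p, c))
    (hasFDerivAt_fderiv_chartMul (E := E) (G := G)) (hasFDerivAt_prodMk_left c c)
  refine (h.clm_apply (hasFDerivAt_const ((0 : E), x) c)).congr_fderiv ?_
  ext v
  simp

/-- The Lie bracket of `𝔤`, read in the model vector space. -/
def bracketE (G : Type*) [TopologicalSpace G] [ChartedSpace E G] [Group G] (v w : E) : E :=
  (⁅(show GroupLieAlgebra 𝓘(ℝ, E) G from v), (show GroupLieAlgebra 𝓘(ℝ, E) G from w)⁆ :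
    GroupLieAlgebra 𝓘(ℝ, E) G)

/-- In the chart, the left-invariant field of x is the derivative of the product in its second
argument along x. The bracket of two such fields therefore antisymmetrises the mixed second
derivative. -/
theorem bracketE_eq_chartHess (v w : E) :
    bracketE G v w = chartHess G (v, 0) (0, w) - chartHess G (w, 0) (0, v) := by
  have : IsManifold 𝓘(ℝ, E) 1 G := IsManifold.of_le (n := ∞) (by simp)
  set c := extChartAt 𝓘(ℝ, E) (1 : G) 1 with hc
  let X : E → E → E := fun x p => fderiv ℝ (chartMul (E := E) (G := G)) (p, c) (0, x)
  have hX : ∀ x : GroupLieAlgebra 𝓘(ℝ, E) G,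
      (mpullbackWithin 𝓘(ℝ, E) 𝓘(ℝ, E) (extChartAt 𝓘(ℝ, E) (1 : G)).symm
        (mulInvariantVectorField x) (Set.range 𝓘(ℝ, E)) : E → E) =ᶠ[𝓝 c] X x := by
    intro x
    filter_upwards [eventually_fderiv_chartMul_inr (E := E) (G := G),
      eventually_mem_target (E := E) (G := G)] with p h1 h2
    refine Eq.trans ?_ (h1 x).symm
    have h3 := ContinuousLinearMap.inverse_eq
      (mfderivWithin_extChartAt_symm_comp_mfderiv_extChartAt (I := 𝓘(ℝ, E)) h2)
      (mfderiv_extChartAt_comp_mfderivWithin_extChartAt_symm (I := 𝓘(ℝ, E)) h2)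
    rw [mpullbackWithin_apply]
    exact DFunLike.congr_fun h3 _
  have hXc : ∀ x : E, X x c = x := by
    intro x
    have h := (eventually_fderiv_chartMul_inr (E := E) (G := G)).self_of_nhds x
    have h1 : (extChartAt 𝓘(ℝ, E) (1 : G)).symm c = 1 := by simp [hc]
    rw [h1, chartDeriv_one, leftDeriv_one] at h
    exact h
  have hfd : ∀ x y : E, fderiv ℝ (X x) c y = chartHess G (y, 0) (0, x) := by
    intro x y
    exact DFunLike.congr_fun (hasFDerivAt_fderiv_chartMul_inr (E := E) (G := G) x).fderiv y
  have h1 : (mfderiv 𝓘(ℝ, E) 𝓘(ℝ, E) (extChartAt 𝓘(ℝ, E) (1 : G)) 1).inverse =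
      ContinuousLinearMap.id ℝ E := by
    have h2 : mfderiv 𝓘(ℝ, E) 𝓘(ℝ, E) (extChartAt 𝓘(ℝ, E) (1 : G)) 1 =
      ContinuousLinearMap.id ℝ _ := mfderiv_extChartAt_self
    rw [h2]
    exact ContinuousLinearMap.inverse_id
  have h5 := Filter.EventuallyEq.lieBracketWithin_vectorField_eq_of_mem (𝕜 := ℝ) (s := Set.univ)
    ((hX v).filter_mono nhdsWithin_le_nhds) ((hX w).filter_mono nhdsWithin_le_nhds)
    (Set.mem_univ c)
  have h6 : lieBracketWithin ℝ (X v) (X w) Set.univ c =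
      chartHess G (v, 0) (0, w) - chartHess G (w, 0) (0, v) := by
    rw [lieBracketWithin_eq]
    simp only [fderivWithin_univ]
    rw [hXc, hXc, hfd, hfd]
  have h7 : (extChartAt 𝓘(ℝ, E) (1 : G)).symm ⁻¹' Set.univ ∩ Set.range 𝓘(ℝ, E) = Set.univ := by
    simp
  unfold bracketE
  rw [GroupLieAlgebra.bracket_def, ← mlieBracketWithin_univ, mlieBracketWithin_apply, h7]
  refine (DFunLike.congr_fun h1 _).trans ?_
  exact h5.trans h6

/-- The differential of the adjoint representation. -/
def adDeriv (G : Type*) [TopologicalSpace G] [ChartedSpace E G] [Group G] : E →L[ℝ] E →L[ℝ] E :=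
  mfderiv 𝓘(ℝ, E) 𝓘(ℝ, E →L[ℝ] E) (adE (E := E) (G := G)) 1

theorem hasMFDerivAt_adE {g : G} (hg : g = 1) :
    HasMFDerivAt 𝓘(ℝ, E) 𝓘(ℝ, E →L[ℝ] E) (adE (E := E) (G := G)) g
      (adDeriv (E := E) G) := by
  subst hg
  exact (contMDiffAt_adE.mdifferentiableAt (by simp)).hasMFDerivAt

/-- The differential of the adjoint representation of `G` is the adjoint representation of `𝔤`. -/
theorem adDeriv_apply (v x : E) : adDeriv G v x = bracketE G v x := by
  set c := extChartAt 𝓘(ℝ, E) (1 : G) 1 with hc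
  have hc1 : (extChartAt 𝓘(ℝ, E) (1 : G)).symm c = 1 := by simp [hc]
  have h1 : HasFDerivAt (fun p => adE (E := E) ((extChartAt 𝓘(ℝ, E) (1 : G)).symm p))
      (adDeriv G) c :=
    ((hasMFDerivAt_adE (E := E) (G := G) hc1).comp c hasMFDerivAt_extChartAt_symm_one).hasFDerivAt
  have h2 : HasFDerivAt (fun p => adE (E := E) ((extChartAt 𝓘(ℝ, E) (1 : G)).symm p) x)
      ((adDeriv G).flip x) c := by
    refine (h1.clm_apply (hasFDerivAt_const x c)).congr_fderiv ?_
    rw [ContinuousLinearMap.comp_zero, zero_add]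
  have h3 : HasFDerivAt (fun p => ((adE (E := E) ((extChartAt 𝓘(ℝ, E) (1 : G)).symm p) x, 0)
      : E × E)) ((ContinuousLinearMap.inl ℝ E E).comp ((adDeriv G).flip x)) c :=
    (ContinuousLinearMap.inl ℝ E E).hasFDerivAt.comp c h2
  have h4 := HasFDerivAt.comp c (f := fun p : E => (c, p))
    (hasFDerivAt_fderiv_chartMul (E := E) (G := G)) (hasFDerivAt_prodMk_right c c)
  have h5 := h4.clm_apply h3
  have h6 := hasFDerivAt_fderiv_chartMul_inr (E := E) (G := G) x
  -- This is `rightDeriv_comp_adE` in the chart. Differentiating both sides at c yields the mixed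
  -- Hessian on the left, and on the right a Hessian term plus the derivative of Ad.
  have h7 : (fun p => fderiv ℝ (chartMul (E := E) (G := G)) (p, c) (0, (x : E))) =ᶠ[𝓝 c]
      fun p => fderiv ℝ (chartMul (E := E) (G := G)) (c, p)
        (adE (E := E) ((extChartAt 𝓘(ℝ, E) (1 : G)).symm p) x, 0) := by
    filter_upwards [eventually_fderiv_chartMul_inr (E := E) (G := G),
      eventually_fderiv_chartMul_inl (E := E) (G := G)] with p e1 e2
    rw [← hc] at e1 e2
    rw [e1, e2, ← rightDeriv_comp_adE]
    rfl
  have h8 := DFunLike.congr_fun (h6.unique (h5.congr_of_eventuallyEq h7)) (v : E)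
  have h9 : ∀ y : E, fderiv ℝ (chartMul (E := E) (G := G)) (c, c) (y, 0) = y := by
    intro y
    have h := (eventually_fderiv_chartMul_inl (E := E) (G := G)).self_of_nhds y
    rw [← hc, hc1, chartDeriv_one, rightDeriv_one] at h
    exact h
  rw [bracketE_eq_chartHess, chartHess_symm (x, 0)]
  refine eq_sub_of_add_eq ?_
  have h10 : adE (E := E) (G := G) 1 x = x := by rw [adE_one]; rfl
  simp only [ContinuousLinearMap.flip_apply, ContinuousLinearMap.comp_apply,
    add_apply, ContinuousLinearMap.inl_apply, ContinuousLinearMap.inr_apply,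
    Function.comp_apply, h9, hc1, h10] at h8
  exact h8.symm

end AdjointDeriv

/-! ### Integral curves of left-invariant fields, in place of the exponential map -/

section IntegralCurves

variable {E : Type*} [NormedAddCommGroup E] [NormedSpace ℝ E]
  {G : Type*} [TopologicalSpace G] [ChartedSpace E G] [Group G] [LieGroup 𝓘(ℝ, E) ∞ G]

theorem contMDiff_one_mulInvariantVectorField (v : GroupLieAlgebra 𝓘(ℝ, E) G) :
    ContMDiff 𝓘(ℝ, E) 𝓘(ℝ, E).tangent 1
      (fun g : G => (⟨g, mulInvariantVectorField v g⟩ : TangentBundle 𝓘(ℝ, E) G)) :=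
  (contMDiff_mulInvariantVectorField v).of_le (by
    rw [minSmoothness_of_isRCLikeNormedField]
    exact_mod_cast one_le_two)

/-- An integral curve of a `C¹` vector field is `C¹`. -/
theorem _root_.IsMIntegralCurve.contMDiff_one {M : Type*} [TopologicalSpace M] [ChartedSpace E M]
    [IsManifold 𝓘(ℝ, E) 1 M]
    {γ : ℝ → M} {V : (x : M) → TangentSpace 𝓘(ℝ, E) x}
    (hV : ContMDiff 𝓘(ℝ, E) 𝓘(ℝ, E).tangent 1
      (fun x => (⟨x, V x⟩ : TangentBundle 𝓘(ℝ, E) M)))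
    (hγ : IsMIntegralCurve γ V) : ContMDiff 𝓘(ℝ, ℝ) 𝓘(ℝ, E) 1 γ := by
  intro t₀
  rw [contMDiffAt_iff]
  refine ⟨hγ.continuous.continuousAt, ?_⟩
  have h1 := (hγ.isMIntegralCurveAt t₀).eventually_hasDerivAt
  have h2 : ∀ᶠ t in 𝓝 t₀, γ t ∈ (chartAt E (γ t₀)).source :=
    hγ.continuous.continuousAt.eventually_mem
      ((chartAt E (γ t₀)).open_source.mem_nhds (mem_chart_source E (γ t₀)))
  have h3 : ContDiffAt ℝ 1 (extChartAt 𝓘(ℝ, E) (γ t₀) ∘ γ) t₀ := by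
    rw [contDiffAt_one_iff]
    refine ⟨fun t => ContinuousLinearMap.toSpanSingleton ℝ
      (tangentCoordChange 𝓘(ℝ, E) (γ t) (γ t₀) (γ t) (V (γ t))), _, h1.and h2, ?_,
      fun t ht => ht.1.hasFDerivAt⟩
    -- In the chart at γ t₀ the velocity is the field along γ read in a trivialisation, hence
    -- continuous.
    have h4 : ContinuousOn (fun t => tangentCoordChange 𝓘(ℝ, E) (γ t) (γ t₀) (γ t) (V (γ t)))
        {t | γ t ∈ (chartAt E (γ t₀)).source} := by
      have h5 : Continuous (fun t => (⟨γ t, V (γ t)⟩ : TangentBundle 𝓘(ℝ, E) M)) :=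
        hV.continuous.comp hγ.continuous
      have h6 := (trivializationAt E (TangentSpace 𝓘(ℝ, E)) (γ t₀)).continuousOn.comp
        h5.continuousOn (s := {t | γ t ∈ (chartAt E (γ t₀)).source})
        (fun t ht => by
          rw [Bundle.Trivialization.mem_source, TangentBundle.trivializationAt_baseSet]
          exact ht)
      exact continuous_snd.comp_continuousOn h6
    exact ((ContinuousLinearMap.toSpanSingletonCLE (𝕜 := ℝ) (E := E)).continuous.comp_continuousOn
      h4).mono fun t ht => ht.2
  exact h3.contDiffWithinAt

theorem mfderiv_mulLeft_mulInvariantVectorField (g h : G) (v : GroupLieAlgebra 𝓘(ℝ, E) G) :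
    mfderiv 𝓘(ℝ, E) 𝓘(ℝ, E) (fun x : G => g * x) h (mulInvariantVectorField v h) =
      mulInvariantVectorField v (g * h) := by
  have h1 : (fun x : G => g * h * x) = (fun x : G => g * x) ∘ fun x : G => h * x := by
    ext x
    simp [mul_assoc]
  unfold mulInvariantVectorField
  rw [h1]
  exact (mfderiv_comp_apply_of_eq (x := (1 : G))
    ((contMDiff_mulLeft (E := E) g h).mdifferentiableAt (by simp))
    ((contMDiff_mulLeft (E := E) h 1).mdifferentiableAt (by simp)) (mul_one h) v).symm

theorem mfderiv_conj_mulInvariantVectorField (g h : G) (v : GroupLieAlgebra 𝓘(ℝ, E) G) :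
    mfderiv 𝓘(ℝ, E) 𝓘(ℝ, E) (fun x : G => g * x * g⁻¹) h (mulInvariantVectorField v h) =
      mulInvariantVectorField (Ad g v) (g * h * g⁻¹) := by
  have h1 : (fun x : G => g * x * g⁻¹) ∘ (fun x : G => h * x) =
      (fun x : G => g * h * g⁻¹ * x) ∘ fun x : G => g * x * g⁻¹ := by
    ext x
    simp [mul_assoc]
  have h2 := mfderiv_comp_apply_of_eq (x := (1 : G))
    ((contMDiff_conj (E := E) g h).mdifferentiableAt (by simp))
    ((contMDiff_mulLeft (E := E) h 1).mdifferentiableAt (by simp)) (mul_one h) v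
  have h3 := mfderiv_comp_apply_of_eq (x := (1 : G)) (y := 1)
    ((contMDiff_mulLeft (E := E) (g * h * g⁻¹) 1).mdifferentiableAt (by simp))
    ((contMDiff_conj (E := E) g 1).mdifferentiableAt (by simp)) (by simp) v
  rw [h1] at h2
  exact h2.symm.trans h3

omit [Group G] [LieGroup 𝓘(ℝ, E) ∞ G] in
theorem hasMFDerivAt_comp_curve {f : G → G} (hf : ContMDiff 𝓘(ℝ, E) 𝓘(ℝ, E) ∞ f)
    {γ : ℝ → G} {s : Set ℝ} {t : ℝ} {v : E}
    (hγ : HasMFDerivWithinAt 𝓘(ℝ, ℝ) 𝓘(ℝ, E) γ s t ((1 : ℝ →L[ℝ] ℝ).smulRight v))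
    {w : E} (hw : mfderiv 𝓘(ℝ, E) 𝓘(ℝ, E) f (γ t) v = w) :
    HasMFDerivWithinAt 𝓘(ℝ, ℝ) 𝓘(ℝ, E) (fun t => f (γ t)) s t
      ((1 : ℝ →L[ℝ] ℝ).smulRight w) := by
  have h := ((hf (γ t)).mdifferentiableAt (by simp)).hasMFDerivAt.comp_hasMFDerivWithinAt t hγ
  refine h.congr_mfderiv ?_
  rw [← hw]
  refine ContinuousLinearMap.ext fun a => ?_
  exact (mfderiv 𝓘(ℝ, E) 𝓘(ℝ, E) f (γ t) : E →L[ℝ] E).map_smul a v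

variable [CompleteSpace E] [T2Space G]

/-- Every `v ∈ 𝔤` is the velocity of a `C¹` curve that commutes with every `g` with `Ad g v = v`. -/
theorem exists_curve (v : GroupLieAlgebra 𝓘(ℝ, E) G) :
    ∃ γ : ℝ → G, ContMDiff 𝓘(ℝ, ℝ) 𝓘(ℝ, E) 1 γ ∧ γ 0 = 1 ∧
      mfderiv 𝓘(ℝ, ℝ) 𝓘(ℝ, E) γ 0 (1 : ℝ) = (v : E) ∧
      ∀ g : G, Ad g v = v → ∀ t, g * γ t * g⁻¹ = γ t := by
  have : IsManifold 𝓘(ℝ, E) 1 G := IsManifold.of_le (n := ∞) (by simp)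
  have hV := contMDiff_one_mulInvariantVectorField (E := E) (G := G) v
  obtain ⟨γ₀, hγ₀1, hγ₀⟩ := exists_isMIntegralCurveAt_of_contMDiffAt_boundaryless
    (I := 𝓘(ℝ, E)) (t₀ := 0) (hV 1)
  rw [isMIntegralCurveAt_iff'] at hγ₀
  obtain ⟨ε, hε, hγ₀⟩ := hγ₀
  -- Left translates of one local solution exist for the same time ε at every point, so the field is
  -- complete.
  obtain ⟨γ, hγ1, hγ⟩ := exists_isMIntegralCurve_of_isMIntegralCurveOn (I := 𝓘(ℝ, E)) hV hε
    (fun x => ⟨fun t => x * γ₀ t, by simp [hγ₀1], fun t ht => by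
      refine hasMFDerivAt_comp_curve (E := E) (contMDiff_mulLeft x)
        (v := mulInvariantVectorField (I := 𝓘(ℝ, E)) v (γ₀ t)) ?_
        (mfderiv_mulLeft_mulInvariantVectorField x (γ₀ t) v)
      have := hγ₀ t (by rwa [Real.ball_eq_Ioo, zero_sub, zero_add])
      rwa [Real.ball_eq_Ioo, zero_sub, zero_add] at this⟩) 1
  refine ⟨γ, hγ.contMDiff_one hV, hγ1, ?_, fun g hg t => ?_⟩
  · rw [(hγ 0).mfderiv, hγ1]
    have h1 : mulInvariantVectorField v (1 : G) = v :=
      DFunLike.congr_fun (leftDeriv_one (E := E)) (v : E)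
    rw [h1]
    exact one_smul ℝ v
  -- The conjugated curve is an integral curve of the same field with the same start, so uniqueness
  -- applies.
  · have h1 : IsMIntegralCurve (I := 𝓘(ℝ, E)) (fun t => g * γ t * g⁻¹)
        (mulInvariantVectorField v) := fun t => by
      refine hasMFDerivWithinAt_univ.1 (hasMFDerivAt_comp_curve (E := E) (contMDiff_conj g)
        (v := mulInvariantVectorField (I := 𝓘(ℝ, E)) v (γ t))
        (hasMFDerivWithinAt_univ.2 (hγ t)) ?_)
      refine (mfderiv_conj_mulInvariantVectorField g (γ t) v).trans ?_
      rw [hg]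
    exact congrFun (isMIntegralCurve_Ioo_eq_of_contMDiff_boundaryless (t₀ := 0) hV h1 hγ
      (by simp [hγ1])) t

end IntegralCurves

end FlagManifold

/-! ### Differentiability of continuous one-parameter groups -/

/-- A continuous one-parameter group in a Banach algebra is differentiable. -/
theorem exists_hasDerivAt_of_continuous_hom {A : Type*} [NormedRing A] [NormedAlgebra ℝ A]
    [CompleteSpace A] {f : ℝ → A} (hf : Continuous f) (h0 : f 0 = 1)
    (hadd : ∀ s t, f (s + t) = f s * f t) : ∃ D : A, ∀ t, HasDerivAt f (f t * D) t := by
  let F : ℝ → A := fun s => ∫ t in (0 : ℝ)..s, f t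
  have hF : ∀ s, HasDerivAt F (f s) s := fun s =>
    intervalIntegral.integral_hasDerivAt_right (hf.intervalIntegrable _ _)
      (hf.stronglyMeasurableAtFilter _ _) hf.continuousAt
  -- The averages of f over [0, ε] tend to f 0 = 1, and units form an open set.
  obtain ⟨ε, hε0, hε⟩ : ∃ ε : ℝ, ε ≠ 0 ∧ IsUnit (ε⁻¹ • F ε) := by
    have h1 := (hF 0).tendsto_slope
    rw [h0] at h1
    have h2 := h1.eventually (Units.isOpen.mem_nhds (isUnit_one (M := A)))
    obtain ⟨ε, h3, h4⟩ := (h2.and self_mem_nhdsWithin).exists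
    refine ⟨ε, h4, ?_⟩
    have h5 : slope F 0 ε = ε⁻¹ • F ε := by
      simp [slope, F]
    rw [← h5]
    exact h3
  obtain ⟨u, hu⟩ := hε
  -- Once F ε is inverted, this expresses f through its differentiable primitive F.
  have hkey : ∀ s, f s * F ε = F (s + ε) - F s := by
    intro s
    have h1 : F (s + ε) - F s = ∫ t in s..(s + ε), f t := by
      rw [intervalIntegral.integral_interval_sub_left] <;> exact hf.intervalIntegrable _ _
    rw [h1]
    have h2 : (∫ t in s..(s + ε), f t) = ∫ t in (0 : ℝ)..ε, f (s + t) := by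
      rw [intervalIntegral.integral_comp_add_left, add_zero]
    rw [h2]
    simp only [hadd]
    exact ((ContinuousLinearMap.mul ℝ A (f s)).intervalIntegral_comp_comm
      (hf.intervalIntegrable 0 ε)).symm
  let W : A := ε⁻¹ • (↑u⁻¹ : A)
  have hW : F ε * W = 1 := by
    have h1 : F ε = ε • (u : A) := by rw [hu, smul_smul, mul_inv_cancel₀ hε0, one_smul]
    rw [h1]
    simp [W, smul_smul, hε0]
  have hf' : f = fun s => (F (s + ε) - F s) * W := by
    funext s
    rw [← hkey, mul_assoc, hW, mul_one]
  refine ⟨(f ε - 1) * W, fun t => ?_⟩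
  have h1 : HasDerivAt (fun s => (F (s + ε) - F s) * W) ((f (t + ε) - f t) * W) t :=
    (((hF (t + ε)).comp_add_const t ε).sub (hF t)).mul_const W
  rw [← hf'] at h1
  have h2 : (f (t + ε) - f t) * W = f t * ((f ε - 1) * W) := by
    rw [hadd, ← mul_assoc, mul_sub, mul_one]
  rwa [h2] at h1

namespace FlagManifold

/-! ### From the group H to its Lie algebra -/

section AdCurves

variable {E : Type*} [NormedAddCommGroup E] [NormedSpace ℝ E]
  {G : Type*} [TopologicalSpace G] [ChartedSpace E G] [Group G] [LieGroup 𝓘(ℝ, E) ∞ G]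

theorem hasDerivAt_adE_curve {γ : ℝ → G} {v : E}
    (hγ : MDifferentiableAt 𝓘(ℝ, ℝ) 𝓘(ℝ, E) γ 0) (h0 : γ 0 = 1)
    (hv : mfderiv 𝓘(ℝ, ℝ) 𝓘(ℝ, E) γ 0 (1 : ℝ) = (v : E)) :
    HasDerivAt (fun t => adE (E := E) (γ t)) (adDeriv G v) 0 := by
  have h1 : HasFDerivAt (fun t => adE (E := E) (γ t))
      ((adDeriv G).comp (mfderiv 𝓘(ℝ, ℝ) 𝓘(ℝ, E) γ 0 : ℝ →L[ℝ] E)) 0 :=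
    ((hasMFDerivAt_adE (E := E) h0).comp 0 hγ.hasMFDerivAt).hasFDerivAt
  have h2 := h1.hasDerivAt
  rw [← hv]
  exact h2

theorem hasDerivAt_adE_curve_apply {γ : ℝ → G} {v : E}
    (hγ : MDifferentiableAt 𝓘(ℝ, ℝ) 𝓘(ℝ, E) γ 0) (h0 : γ 0 = 1)
    (hv : mfderiv 𝓘(ℝ, ℝ) 𝓘(ℝ, E) γ 0 (1 : ℝ) = (v : E)) (x : E) :
    HasDerivAt (fun t => adE (E := E) (γ t) x) (bracketE G v x) 0 := by
  rw [← adDeriv_apply]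
  have h := (hasDerivAt_adE_curve hγ h0 hv).clm_apply (hasDerivAt_const (0 : ℝ) x)
  simpa using h

theorem adE_adE_inv (g : G) (x : E) : adE (E := E) g (adE g⁻¹ x) = x := by
  rw [← ContinuousLinearMap.comp_apply, ← adE_mul, mul_inv_cancel, adE_one]
  rfl

theorem adE_inv_adE (g : G) (x : E) : adE (E := E) g⁻¹ (adE g x) = x := by
  rw [← ContinuousLinearMap.comp_apply, ← adE_mul, inv_mul_cancel, adE_one]
  rfl

/-- Differentiate Ad(g) Ad(γ t) = Ad(g γ(t) g⁻¹) Ad(g) along a curve with velocity v. -/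
theorem adE_bracketE [CompleteSpace E] [T2Space G] (g : G) (v x : E) :
    adE g (bracketE G v x) = bracketE G (adE g v) (adE g x) := by
  obtain ⟨γ, h1, h2, h3, -⟩ := exists_curve (E := E) (G := G) v
  have hd : MDifferentiableAt 𝓘(ℝ, ℝ) 𝓘(ℝ, E) γ 0 := (h1 0).mdifferentiableAt (by simp)
  have h4 := (adE (E := E) g).hasFDerivAt.comp_hasDerivAt (0 : ℝ)
    (hasDerivAt_adE_curve_apply hd h2 h3 x)
  have hc : MDifferentiableAt 𝓘(ℝ, E) 𝓘(ℝ, E) (fun x : G => g * x * g⁻¹) (γ 0) :=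
    (contMDiff_conj g (γ 0)).mdifferentiableAt (by simp)
  have h5 := hasDerivAt_adE_curve_apply (γ := (fun x : G => g * x * g⁻¹) ∘ γ) (v := adE g v)
    (hc.comp 0 hd) (by simp [h2]) ((mfderiv_comp_apply_of_eq (x := (0 : ℝ)) (y := 1)
      ((contMDiff_conj g 1).mdifferentiableAt (by simp)) hd h2 (1 : ℝ)).trans
        (congrArg (adE (E := E) g) h3)) (adE g x)
  refine h4.unique (h5.congr_of_eventuallyEq (Filter.Eventually.of_forall fun t => ?_))
  change adE (E := E) g (adE (γ t) x) = adE (g * γ t * g⁻¹) (adE g x)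
  rw [adE_mul, adE_mul, ContinuousLinearMap.comp_apply, ContinuousLinearMap.comp_apply,
    adE_inv_adE]

theorem Ad_lie [CompleteSpace E] [T2Space G] (g : G) (v x : GroupLieAlgebra 𝓘(ℝ, E) G) :
    Ad g ⁅v, x⁆ = ⁅Ad g v, Ad g x⁆ := adE_bracketE (E := E) g v x

/-- A curve in the centraliser is unchanged by conjugation with s, and so is its velocity.
Conversely, the integral curve of an `Ad(S)`-fixed vector commutes with S. -/
theorem mem_tangentAlgebra_centralizer [CompleteSpace E] [T2Space G] (S : Subgroup G)
    (v : GroupLieAlgebra 𝓘(ℝ, E) G) :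
    v ∈ tangentAlgebra (Subgroup.centralizer (S : Set G)) ↔ ∀ s ∈ S, Ad s v = v := by
  constructor
  · rintro ⟨γ, h1, h2, h3, h4⟩ s hs
    have hd : MDifferentiableAt 𝓘(ℝ, ℝ) 𝓘(ℝ, E) γ 0 := (h1 0).mdifferentiableAt (by simp)
    have h5 : (fun x : G => s * x * s⁻¹) ∘ γ = γ := by
      funext t
      have := Subgroup.mem_centralizer_iff.1 (h2 t) s hs
      simp [this]
    have h6 := mfderiv_comp_apply_of_eq (x := (0 : ℝ)) (y := 1)
      ((contMDiff_conj (E := E) s 1).mdifferentiableAt (by simp)) hd h3 (1 : ℝ)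
    rw [h5, h4] at h6
    exact h6.symm
  · intro h
    obtain ⟨γ, h1, h2, h3, h4⟩ := exists_curve (E := E) (G := G) v
    refine ⟨γ, h1, fun t => Subgroup.mem_centralizer_iff.2 fun s hs => ?_, h2, h3⟩
    have := h4 s (h s hs) t
    rw [mul_inv_eq_iff_eq_mul] at this
    exact this

/-- `Ad(H)`-invariant subspaces are `ad(𝔥)`-invariant. -/
theorem IsAdInvariant.lie_mem [FiniteDimensional ℝ E] {H : Subgroup G}
    {u : Submodule ℝ (GroupLieAlgebra 𝓘(ℝ, E) G)} (hu : IsAdInvariant H u)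
    {v x : GroupLieAlgebra 𝓘(ℝ, E) G} (hv : v ∈ tangentAlgebra H) (hx : x ∈ u) : ⁅v, x⁆ ∈ u := by
  obtain ⟨γ, h1, h2, h3, h4⟩ := hv
  have hd : MDifferentiableAt 𝓘(ℝ, ℝ) 𝓘(ℝ, E) γ 0 := (h1 0).mdifferentiableAt (by simp)
  have h5 := (hasDerivAt_adE_curve_apply hd h3 h4 x).tendsto_slope
  let u' : Submodule ℝ E := u
  have hcl : IsClosed (u' : Set E) := u'.closed_of_finiteDimensional
  refine hcl.mem_of_tendsto h5 (Filter.Eventually.of_forall fun t => ?_)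
  rw [slope]
  exact u'.smul_mem _ (u'.sub_mem (hu _ (h2 t) _ hx) (hu _ (h2 0) _ hx))

theorem AdEquivalent.map_lie [FiniteDimensional ℝ E] {H : Subgroup G}
    {u w : Submodule ℝ (GroupLieAlgebra 𝓘(ℝ, E) G)} (hu : IsAdInvariant H u) (f : u ≃ₗ[ℝ] w)
    (hf : ∀ h ∈ H, ∀ (x : u) (hx : Ad h (x : GroupLieAlgebra 𝓘(ℝ, E) G) ∈ u),
      (f ⟨Ad h (x : GroupLieAlgebra 𝓘(ℝ, E) G), hx⟩ : GroupLieAlgebra 𝓘(ℝ, E) G) =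
        Ad h (f x : GroupLieAlgebra 𝓘(ℝ, E) G))
    {v : GroupLieAlgebra 𝓘(ℝ, E) G} (hv : v ∈ tangentAlgebra H) (x : u)
    (hx : ⁅v, (x : GroupLieAlgebra 𝓘(ℝ, E) G)⁆ ∈ u) :
    (f ⟨⁅v, (x : GroupLieAlgebra 𝓘(ℝ, E) G)⁆, hx⟩ : GroupLieAlgebra 𝓘(ℝ, E) G) =
      ⁅v, (f x : GroupLieAlgebra 𝓘(ℝ, E) G)⁆ := by
  obtain ⟨γ, h1, h2, h3, h4⟩ := hv
  have hd : MDifferentiableAt 𝓘(ℝ, ℝ) 𝓘(ℝ, E) γ 0 := (h1 0).mdifferentiableAt (by simp)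
  let u' : Submodule ℝ E := u
  let f' : u' →ₗ[ℝ] E := w.subtype ∘ₗ (f : u →ₗ[ℝ] w)
  -- Extending f to all of `E` lets the derivative pass through it.
  obtain ⟨F, hF⟩ := f'.exists_extend
  have hFx : ∀ y (hy : y ∈ u'), F y = f' ⟨y, hy⟩ := fun y hy => LinearMap.congr_fun hF ⟨y, hy⟩
  have h5 := (LinearMap.toContinuousLinearMap F).hasFDerivAt.comp_hasDerivAt (0 : ℝ)
    (hasDerivAt_adE_curve_apply hd h3 h4 ((x : GroupLieAlgebra 𝓘(ℝ, E) G) : E))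
  have h6 := hasDerivAt_adE_curve_apply hd h3 h4 ((f x : GroupLieAlgebra 𝓘(ℝ, E) G) : E)
  have h7 := h5.unique (h6.congr_of_eventuallyEq (Filter.Eventually.of_forall fun t =>
    (hFx _ (hu _ (h2 t) _ x.2)).trans (hf _ (h2 t) x (hu _ (h2 t) _ x.2))))
  exact (hFx _ hx).symm.trans h7

end AdCurves

/-! ### Invariance of the scalar product -/

section ScalarProduct

variable {E : Type*} [NormedAddCommGroup E] [NormedSpace ℝ E]
  {G : Type*} [TopologicalSpace G] [ChartedSpace E G] [Group G] [LieGroup 𝓘(ℝ, E) ∞ G]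
  {g : Bundle.ContMDiffRiemannianMetric 𝓘(ℝ, E) ∞ E (TangentSpace 𝓘(ℝ, E) : G → Type _)}

theorem scalarProduct_symm (x y : GroupLieAlgebra 𝓘(ℝ, E) G) :
    scalarProduct g x y = scalarProduct g y x := g.symm 1 x y

theorem scalarProduct_pos (x : GroupLieAlgebra 𝓘(ℝ, E) G) (hx : x ≠ 0) :
    0 < scalarProduct g x x := g.pos 1 x hx

theorem scalarProduct_Ad (hg : IsBiInvariant g) (h : G) (x y : GroupLieAlgebra 𝓘(ℝ, E) G) :
    scalarProduct g (Ad h x) (Ad h y) = scalarProduct g x y := by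
  have key : ∀ (p : G) (_ : p = 1) (v w : E), g.inner p v w = g.inner (1 : G) v w := by
    rintro p rfl v w
    rfl
  have h1 := hg.left h 1 x y
  have h2 := hg.right h⁻¹ (h * 1) (mfderiv 𝓘(ℝ, E) 𝓘(ℝ, E) (fun y : G => h * y) 1 x)
    (mfderiv 𝓘(ℝ, E) 𝓘(ℝ, E) (fun y : G => h * y) 1 y)
  have h3 : ∀ v : GroupLieAlgebra 𝓘(ℝ, E) G, (Ad h v : E) =
      mfderiv 𝓘(ℝ, E) 𝓘(ℝ, E) (fun y : G => y * h⁻¹) (h * 1)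
        (mfderiv 𝓘(ℝ, E) 𝓘(ℝ, E) (fun y : G => h * y) 1 v) := fun v =>
    mfderiv_comp_apply (1 : G)
      ((contMDiff_mulRight (E := E) h⁻¹ (h * 1)).mdifferentiableAt (by simp))
      ((contMDiff_mulLeft (E := E) h 1).mdifferentiableAt (by simp)) v
  rw [h1] at h2
  rw [← h3, ← h3] at h2
  exact (key (h * 1 * h⁻¹) (by simp) _ _).symm.trans h2

/-- The infinitesimal form of `scalarProduct_Ad`, by the product rule along a curve with velocity x.
-/
theorem scalarProduct_lie [CompleteSpace E] [T2Space G] (hg : IsBiInvariant g)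
    (x y z : GroupLieAlgebra 𝓘(ℝ, E) G) :
    scalarProduct g ⁅x, y⁆ z = - scalarProduct g y ⁅x, z⁆ := by
  let B : E →L[ℝ] E →L[ℝ] ℝ := g.inner (1 : G)
  have main : ∀ x y z : E, B (bracketE G x y) z + B y (bracketE G x z) = 0 := by
    intro x y z
    obtain ⟨γ, h1, h2, h3, -⟩ := exists_curve (E := E) (G := G) x
    have hd : MDifferentiableAt 𝓘(ℝ, ℝ) 𝓘(ℝ, E) γ 0 := (h1 0).mdifferentiableAt (by simp)
    have h4 := hasDerivAt_adE_curve_apply hd h2 h3 y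
    have h5 := hasDerivAt_adE_curve_apply hd h2 h3 z
    have h6 := (B.hasFDerivAt.comp_hasDerivAt (0 : ℝ) h4).clm_apply h5
    have h7 : (fun t => B (adE (E := E) (γ t) y) (adE (E := E) (γ t) z)) = fun _ => B y z :=
      funext fun t => scalarProduct_Ad hg (γ t) y z
    have h8 := (h6.congr_of_eventuallyEq (Filter.EventuallyEq.of_eq h7.symm)).unique
      (hasDerivAt_const (0 : ℝ) (B y z))
    have h9 : ∀ w : E, adE (E := E) (γ 0) w = w := fun w => by rw [h2, adE_one]; rfl
    simpa only [Function.comp_apply, h9] using h8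
  exact eq_neg_of_add_eq_zero_left (main x y z)

end ScalarProduct

/-! ### One-parameter subgroups of a torus -/

section Torus

variable {E : Type*} [NormedAddCommGroup E] [NormedSpace ℝ E]
  {G : Type*} [TopologicalSpace G] [ChartedSpace E G] [Group G]

instance instFiniteDimensionalGroupLieAlgebra [FiniteDimensional ℝ E] :
    FiniteDimensional ℝ (GroupLieAlgebra 𝓘(ℝ, E) G) :=
  inferInstanceAs (FiniteDimensional ℝ E)

omit [ChartedSpace E G] in
/-- Every element of a torus lies on a continuous one-parameter subgroup of the torus. -/
theorem IsTorus.exists_hom {S : Subgroup G} (hS : IsTorus S) {s : G} (hs : s ∈ S) :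
    ∃ φ : ℝ → G, Continuous φ ∧ (∀ t, φ t ∈ S) ∧ φ 0 = 1 ∧
      (∀ a b, φ (a + b) = φ a * φ b) ∧ φ 1 = s := by
  obtain ⟨k, ⟨e⟩⟩ := hS
  have hθ : ∀ i, ∃ θ : ℝ, Circle.exp θ = e ⟨s, hs⟩ i := fun i => Circle.exp_surjective _
  choose θ hθ using hθ
  let ψ : ℝ → Fin k → Circle := fun t i => Circle.exp (t * θ i)
  have hψ : Continuous ψ := continuous_pi fun i =>
    Circle.exp.continuous.comp (continuous_id.mul continuous_const)
  refine ⟨fun t => e.symm (ψ t), continuous_subtype_val.comp (e.symm.continuous.comp hψ),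
    fun t => (e.symm (ψ t)).2, ?_, fun a b => ?_, ?_⟩
  · have : ψ 0 = 1 := by
      funext i
      simp [ψ]
    simp [this]
  · have : ψ (a + b) = ψ a * ψ b := by
      funext i
      simp [ψ, add_mul, Circle.exp_add]
    simp [this]
  · have : ψ 1 = e ⟨s, hs⟩ := by
      funext i
      simp [ψ, hθ]
    simp [this]

end Torus

/-! ### Centralisers of tori and the isotropy representation -/

section Flag

variable {E : Type*} [NormedAddCommGroup E] [NormedSpace ℝ E] [FiniteDimensional ℝ E]
  [CompleteSpace E] {G : Type*} [TopologicalSpace G] [ChartedSpace E G] [Group G]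
  [LieGroup 𝓘(ℝ, E) ∞ G] [T2Space G]

/-- The velocity of a one-parameter group of automorphisms of `𝔤`, as a derivation. -/
def derivationOfHom {a : ℝ → G} {D : E →L[ℝ] E} (h0 : a 0 = 1)
    (hD : HasDerivAt (fun t => adE (E := E) (a t)) D 0) :
    LieDerivation ℝ (GroupLieAlgebra 𝓘(ℝ, E) G) (GroupLieAlgebra 𝓘(ℝ, E) G) where
  toLinearMap := (D : E →ₗ[ℝ] E)
  leibniz' x y := by
    have main : ∀ x y : E, D (bracketE G x y) = bracketE G x (D y) + bracketE G (D x) y := by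
      intro x y
      have h1 : ∀ z : E, HasDerivAt (fun t => adE (E := E) (a t) z) (D z) 0 := fun z => by
        simpa using hD.clm_apply (hasDerivAt_const (0 : ℝ) z)
      have h2 := ((adDeriv (E := E) G).hasFDerivAt.comp_hasDerivAt (0 : ℝ) (h1 x)).clm_apply (h1 y)
      have h3 : ∀ w : E, adE (E := E) (a 0) w = w := fun w => by rw [h0, adE_one]; rfl
      have h4 := (h1 (bracketE G x y)).unique (h2.congr_of_eventuallyEq
        (Filter.Eventually.of_forall fun t => by
          simp only [Function.comp_apply, adDeriv_apply]
          exact adE_bracketE (a t) x y))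
      simp only [Function.comp_apply, h3, adDeriv_apply] at h4
      rw [h4, add_comm]
    have h5 : bracketE (E := E) G (D x) y = - bracketE (E := E) G y (D x) :=
      (lie_skew (show GroupLieAlgebra 𝓘(ℝ, E) G from D x) y).symm
    refine (main x y).trans ?_
    rw [h5]
    exact (sub_eq_add_neg _ _).symm

omit [FiniteDimensional ℝ E] [T2Space G] in
theorem exists_hasDerivAt_adE_hom {φ : ℝ → G} (hφ : Continuous φ) (h0 : φ 0 = 1)
    (hadd : ∀ a b, φ (a + b) = φ a * φ b) :
    ∃ D : E →L[ℝ] E, HasDerivAt (fun t => adE (E := E) (φ t)) D 0 ∧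
      ∀ x, D x = 0 → ∀ t, adE (E := E) (φ t) x = x := by
  obtain ⟨D, hD⟩ := exists_hasDerivAt_of_continuous_hom (A := E →L[ℝ] E)
    (f := fun t => adE (E := E) (φ t)) (continuous_adE.comp hφ)
    (by simp only [h0]; exact adE_one) (fun s t => by simp only [hadd]; exact adE_mul _ _)
  refine ⟨D, ?_, fun x hx t => ?_⟩
  · have := hD 0
    rwa [h0, adE_one, show (ContinuousLinearMap.id ℝ E : E →L[ℝ] E) = 1 from rfl, one_mul] at this
  · have h1 : ∀ t, HasDerivAt (fun t => adE (E := E) (φ t) x) 0 t := fun t => by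
      have := (hD t).clm_apply (hasDerivAt_const t x)
      simpa [hx] using this
    have h2 := is_const_of_deriv_eq_zero (fun t => (h1 t).differentiableAt)
      (fun t => (h1 t).deriv) t 0
    rw [h2, h0, adE_one]
    rfl

variable {g : Bundle.ContMDiffRiemannianMetric 𝓘(ℝ, E) ∞ E (TangentSpace 𝓘(ℝ, E) : G → Type _)}

/-- The centraliser of the `Ad(H)`-fixed vectors of `𝔥` is contained in `𝔥`. -/
theorem mem_tangentAlgebra_of_lie_eq_zero {H : Subgroup G} (hH : IsGeneralisedFlagManifold E H)
    (hg : IsBiInvariant g) (x : GroupLieAlgebra 𝓘(ℝ, E) G)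
    (hx : ∀ v : GroupLieAlgebra 𝓘(ℝ, E) G, v ∈ tangentAlgebra H →
      (∀ h ∈ H, Ad h v = v) → ⁅v, x⁆ = 0) :
    x ∈ tangentAlgebra H := by
  obtain ⟨hss, S, hS, rfl⟩ := hH
  have hcenter : LieAlgebra.center ℝ (GroupLieAlgebra 𝓘(ℝ, E) G) = ⊥ :=
    LieAlgebra.center_eq_bot ℝ _
  have hK := LieAlgebra.isKilling_of_invariant (scalarProduct g) scalarProduct_symm
    scalarProduct_pos (scalarProduct_lie hg) hcenter
  rw [mem_tangentAlgebra_centralizer]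
  intro s hs
  obtain ⟨φ, hφ, hφS, h0, hadd, h1⟩ := hS.exists_hom hs
  obtain ⟨D, hD, hDx⟩ := exists_hasDerivAt_adE_hom (E := E) hφ h0 hadd
  -- Derivations are inner because the Killing form is nondegenerate. No claim that v is tangent to
  -- S is needed.
  obtain ⟨v, hvD⟩ : ∃ v : E, ∀ y : E, bracketE G v y = D y := by
    obtain ⟨v, hv⟩ := LieDerivation.IsKilling.exists_eq_ad (derivationOfHom h0 hD)
    exact ⟨v, fun y =>
      (LinearMap.congr_fun (LieDerivation.coe_ad_apply_eq_ad_apply (R := ℝ) v) y).symm.trans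
        (LieDerivation.congr_fun hv y)⟩
  -- `v` is fixed by everything that centralises `S`
  have hfix : ∀ h ∈ Subgroup.centralizer (S : Set G), Ad (E := E) h v = v := by
    intro h hh
    have hcomm : ∀ y : E, adE (E := E) h (D y) = D (adE h y) := by
      intro y
      have e1 : ∀ z : E, HasDerivAt (fun t => adE (E := E) (φ t) z) (D z) 0 := fun z => by
        simpa using hD.clm_apply (hasDerivAt_const (0 : ℝ) z)
      have e2 := (adE (E := E) h).hasFDerivAt.comp_hasDerivAt (0 : ℝ) (e1 y)
      refine e2.unique ((e1 (adE h y)).congr_of_eventuallyEq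
        (Filter.Eventually.of_forall fun t => ?_))
      have e3 := Subgroup.mem_centralizer_iff.1 hh (φ t) (hφS t)
      change adE (E := E) h (adE (φ t) y) = adE (φ t) (adE h y)
      rw [← ContinuousLinearMap.comp_apply, ← ContinuousLinearMap.comp_apply, ← adE_mul,
        ← adE_mul, e3]
    have h2 : ∀ y : E, bracketE G (adE h v) y = bracketE G v y := by
      intro y
      rw [← adE_adE_inv h y, ← adE_bracketE, hvD, hvD, hcomm]
    have h3 : (Ad (E := E) h v - (show GroupLieAlgebra 𝓘(ℝ, E) G from v)) ∈
        LieAlgebra.center ℝ (GroupLieAlgebra 𝓘(ℝ, E) G) := by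
      rw [LieModule.mem_maxTrivSubmodule]
      intro y
      rw [← lie_skew, sub_lie, neg_eq_zero, sub_eq_zero]
      exact h2 y
    rw [hcenter, LieSubmodule.mem_bot, sub_eq_zero] at h3
    exact h3
  have hSH : ∀ s ∈ S, s ∈ Subgroup.centralizer (S : Set G) := by
    obtain ⟨k, ⟨e⟩⟩ := hS
    intro s hs
    rw [Subgroup.mem_centralizer_iff]
    intro s' hs'
    have : (⟨s', hs'⟩ : S) * ⟨s, hs⟩ = ⟨s, hs⟩ * ⟨s', hs'⟩ :=
      e.injective (by rw [map_mul, map_mul, mul_comm])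
    exact congrArg Subtype.val this
  -- S is abelian, hence contained in its centraliser, so v is fixed by `Ad(S)`.
  have hvH : v ∈ tangentAlgebra (Subgroup.centralizer (S : Set G)) :=
    (mem_tangentAlgebra_centralizer S v).2 fun s hs => hfix s (hSH s hs)
  have hDx0 : D x = 0 := (hvD x).symm.trans (hx v hvH hfix)
  have := hDx x hDx0 1
  rw [h1] at this
  exact this

omit [FiniteDimensional ℝ E] [T2Space G] in
/-- A vector fixed by `Ad(H)` commutes with `𝔥`. -/
theorem lie_eq_zero_of_Ad_eq {H : Subgroup G} {v : GroupLieAlgebra 𝓘(ℝ, E) G}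
    (hv : ∀ h ∈ H, Ad h v = v) {y : GroupLieAlgebra 𝓘(ℝ, E) G} (hy : y ∈ tangentAlgebra H) :
    ⁅v, y⁆ = 0 := by
  obtain ⟨γ, h1, h2, h3, h4⟩ := hy
  have hd : MDifferentiableAt 𝓘(ℝ, ℝ) 𝓘(ℝ, E) γ 0 := (h1 0).mdifferentiableAt (by simp)
  have h5 := (hasDerivAt_adE_curve_apply hd h3 h4 (v : E)).unique
    ((hasDerivAt_const (F := E) (0 : ℝ) v).congr_of_eventuallyEq
      (Filter.Eventually.of_forall fun t => hv _ (h2 t)))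
  rw [← lie_skew, neg_eq_zero]
  exact h5

/-- Only u must lie in 𝔪, and u ⟂ v is the sole link between them; this serves both the subalgebra
condition and the irreducible decompositions. -/
theorem not_adEquivalent_of_orthogonal {H : Subgroup G} (hH : IsGeneralisedFlagManifold E H)
    (hg : IsBiInvariant g) {u v : Submodule ℝ (GroupLieAlgebra 𝓘(ℝ, E) G)} (hu : u ≠ ⊥)
    (hui : IsAdInvariant H u) (hum : u ≤ isotropySpace (scalarProduct g) H)
    (huv : ∀ x ∈ u, ∀ y ∈ v, scalarProduct g x y = 0) : ¬ AdEquivalent H u v := by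
  rintro ⟨f, hf⟩
  exact no_equivariant_embedding (scalarProduct g) scalarProduct_symm scalarProduct_pos
    (scalarProduct_lie hg) (tangentAlgebra H) {v | v ∈ tangentAlgebra H ∧ ∀ h ∈ H, Ad h v = v}
    (fun _ hv => hv.1) (fun _ hv _ hy => lie_eq_zero_of_Ad_eq hv.2 hy)
    (fun x hx => mem_tangentAlgebra_of_lie_eq_zero hH hg x fun v hv hv' => hx v ⟨hv, hv'⟩)
    u v hu (fun _ hx _ hy => hui.lie_mem hx hy)
    (fun x hx y hy => (hum hy).2 x hx) huv
    (f : u →ₗ[ℝ] v) f.injective (fun _ hx y hy => AdEquivalent.map_lie hui f hf hx y hy)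

theorem IsAdIrreducible.even_finrank {H : Subgroup G} (hH : IsGeneralisedFlagManifold E H)
    (hg : IsBiInvariant g) {u : Submodule ℝ (GroupLieAlgebra 𝓘(ℝ, E) G)}
    (hu : IsAdIrreducible H u) (hum : u ≤ isotropySpace (scalarProduct g) H) :
    Even (Module.finrank ℝ u) := by
  obtain ⟨hui, hu0, hirr⟩ := hu
  obtain ⟨x, hxu, hx0⟩ := (Submodule.ne_bot_iff _).1 hu0
  obtain ⟨v, hv, hvH, hvx⟩ : ∃ v ∈ tangentAlgebra H, (∀ h ∈ H, Ad h v = v) ∧ ⁅v, x⁆ ≠ 0 := by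
    by_contra hcon
    push Not at hcon
    have hx := mem_tangentAlgebra_of_lie_eq_zero hH hg x hcon
    exact (scalarProduct_pos (g := g) x hx0).ne' ((hum hxu).2 x hx)
  let T := (LieAlgebra.ad ℝ (GroupLieAlgebra 𝓘(ℝ, E) G) v).restrict
    (p := u) (q := u) (fun y hy => hui.lie_mem hv hy)
  refine LinearMap.BilinForm.even_finrank_of_skew ((scalarProduct g).restrict u)
    (fun y hy => scalarProduct_pos _ (by simpa using hy)) T
    (fun y z => scalarProduct_lie hg v y z) ?_
  -- v is `Ad(H)`-fixed, so the kernel of ad v on u is `Ad(H)`-invariant; it is not all of u because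
  -- it misses x.
  have hker : u ⊓ LinearMap.ker (LieAlgebra.ad ℝ (GroupLieAlgebra 𝓘(ℝ, E) G) v) = ⊥ := by
    refine (hirr _ inf_le_left ?_).resolve_right ?_
    · rintro h hh y ⟨hy1, hy2⟩
      refine ⟨hui h hh y hy1, ?_⟩
      have e1 : ⁅v, y⁆ = 0 := hy2
      have e2 := Ad_lie h v y
      rw [e1, hvH h hh, map_zero] at e2
      exact e2.symm
    · intro heq
      rw [← heq] at hxu
      exact hvx hxu.2
  rw [← LinearMap.ker_eq_bot, LinearMap.ker_eq_bot']
  rintro ⟨y, hy⟩ hTy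
  have : y ∈ (⊥ : Submodule ℝ (GroupLieAlgebra 𝓘(ℝ, E) G)) := by
    rw [← hker]
    exact ⟨hy, congrArg Subtype.val hTy⟩
  exact Subtype.ext this

omit [CompleteSpace E] [LieGroup 𝓘(ℝ, E) ∞ G] [T2Space G] in
theorem isAdIrreducible_of_finrank_eq_one {H : Subgroup G}
    {u : Submodule ℝ (GroupLieAlgebra 𝓘(ℝ, E) G)} (hu : IsAdInvariant H u)
    (h1 : Module.finrank ℝ u = 1) : IsAdIrreducible H u := by
  refine ⟨hu, ?_, fun w hw _ => ?_⟩
  · rintro rfl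
    simp at h1
  · rcases Nat.eq_zero_or_pos (Module.finrank ℝ w) with h | h
    · exact Or.inl (Submodule.finrank_eq_zero.1 h)
    · exact Or.inr (Submodule.eq_of_le_of_finrank_le hw (by omega))

end Flag

end FlagManifold

end

theorem proposition4p1
    {E : Type*} [NormedAddCommGroup E] [NormedSpace ℝ E] [FiniteDimensional ℝ E] [CompleteSpace E]
    {G : Type*} [TopologicalSpace G] [ChartedSpace E G] [Group G] [LieGroup 𝓘(ℝ, E) ∞ G]
    [T2Space G] [CompactSpace G] [ConnectedSpace G]
    (H : Subgroup G) (hH : IsGeneralisedFlagManifold E H)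
    (g : Bundle.ContMDiffRiemannianMetric 𝓘(ℝ, E) ∞ E (TangentSpace 𝓘(ℝ, E) : G → Type _))
    (hg : IsBiInvariant g) :
    SubalgebraHypothesis (scalarProduct g) H ∧
    (∀ (s : ℕ) (m : Fin s → Submodule ℝ (GroupLieAlgebra 𝓘(ℝ, E) G)),
      IsIsotropyDecomposition (scalarProduct g) H m →
        (∀ i j, i ≠ j → ¬ AdEquivalent H (m i) (m j)) ∧
        (∀ i, Even (Module.finrank ℝ (m i)))) ∧
    (∀ r : Submodule ℝ (GroupLieAlgebra 𝓘(ℝ, E) G),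
      r ≤ isotropySpace (scalarProduct g) H → IsAdInvariant H r → Module.finrank ℝ r ≠ 1) := by
  have h3 : ∀ r : Submodule ℝ (GroupLieAlgebra 𝓘(ℝ, E) G),
      r ≤ isotropySpace (scalarProduct g) H → IsAdInvariant H r → Module.finrank ℝ r ≠ 1 := by
    intro r hr hri h1
    have := (isAdIrreducible_of_finrank_eq_one hri h1).even_finrank hH hg hr
    rw [h1] at this
    exact absurd this (by decide)
  refine ⟨fun s hs => ⟨fun u v hu hv hui hvi hus hvs => ?_, fun r hr hri hrs => ?_⟩,
    fun s m hm => ⟨fun i j hij => ?_, fun i => ?_⟩, h3⟩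
  · refine not_adEquivalent_of_orthogonal hH hg hu hui (fun x hx => ⟨trivial, (hus hx).2⟩) ?_
    intro x hx y hy
    exact (hvs hy).2 x (hus hx).1
  -- Being orthogonal to 𝔰 ⊇ 𝔥, the line r would lie in 𝔪, where there are no invariant lines.
  · exact absurd hr (h3 r (fun x hx => ⟨trivial, fun y hy => (hrs hx).2 y (hs.le hy)⟩) hri)
  · exact not_adEquivalent_of_orthogonal hH hg (hm.irreducible i).2.1 (hm.irreducible i).1
      (hm.iSup_eq ▸ le_iSup m i) (hm.orthogonal i j hij)
  · exact (hm.irreducible i).even_finrank hH hg (hm.iSup_eq ▸ le_iSup m i)
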